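/- Let $q$ be a prime power, $F=\mathrm{GF}(q)$, $K=\mathrm{GF}(q^3)$, and fix an $F$-basis $b_0,b_1,b_2$ of $K$ (for example $1,\tau,\tau^2$ with $\tau$ primitive). Let $\ell_\infty$ be the line $z=0$ of $\mathrm{PG}(2,q^3)$, and let $\Sigma_\infty$ be the hyperplane $z=0$ of $\mathrm{PG}(6,q)$, whose points have coordinates $(x_0,x_1,x_2,y_0,y_1,y_2,z)$. In the Bruck–Bose representation, an affine point $(\sum x_ib_i,\sum y_ib_i,1)$ of $\mathrm{PG}(2,q^3)$ corresponds to the point $(x_0,x_1,x_2,y_0,y_1,y_2,1)$ of $\mathrm{PG}(6,q)$, and a point $X=(\alpha,\beta,0)$ of $\ell_\infty$ corresponds to the plane $[X]=\{(x,y,0) : (\sum x_ib_i,\sum y_ib_i)\in K(\alpha,\beta)\}$ of $\Sigma_\infty$. These planes form a regular spread $\mathcal S$. An order-$q$-subplane is an image of $\mathrm{PG}(2,q)$ under $\mathrm{PGL}(3,q^3)$. Let $g$ be the line of $\mathrm{PG}(6,q^3)$ consisting of the points $(x,y,0)$ with $M_ax=ax$ and $M_ay=ay$ for all $a\in K$,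 where $M_a$ is the matrix of multiplication by $a$ in the basis $b$. Its conjugates $g,g^q,g^{q^2}$ are the transversals of $\mathcal S$. A special twisted cubic is a twisted cubic of $\mathrm{PG}(6,q)$ that lies in a $3$-space which contains an element of $\mathcal S$ and is not contained in $\Sigma_\infty$, and whose extension to $\mathrm{PG}(6,q^3)$ meets $g,g^q,g^{q^2}$. Let $\mathscr B$ be an order-$q$-subplane of $\mathrm{PG}(2,q^3)$ that meets $\ell_\infty$ in exactly one point $T$, and let $P\in\mathscr B$ be an affine point. 1. For each line $\ell$ of $\mathscr B$ with $P\in\ell$ and $T\notin\ell$, the points of $\ell$ correspond to the points of a special twisted cubic $[\ell]$, and the point $I_{P,\ell}$ in which the tangent line of $[\ell]$ at $P$ meets $\Sigma_\infty$ is well defined. 2. There is a unique line $I_P$ of $\mathrm{PG}(6,q)$ that contains all the points $I_{P,\ell}$. 3. There is a unique order-$q$-subplane $P^\perp$ that contains the points in which the (extended) lines of $\mathscr B$ through $P$ meet $\ell_\infty$ and the points of $\mathscr B$ on the line $PT$. 4. There is a unique plane $[P^\perp]$ of $\mathrm{PG}(6,q)$, not contained in $\Sigma_\infty$, whose affine points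 are those that correspond to the affine points of $P^\perp$ and which meets $[X]$, for $X\in\ell_\infty$, if and only if $X\in P^\perp$. This plane is $[P^\perp]=\langle P,I_P\rangle$. -/

import Mathlib

open scoped LinearAlgebra.Projectivization

namespace BruckBose

section Plane

/-- The points of the projective plane `PG(2,q³)`, where `K = GF(q³)`. -/
abbrev PG2 (K : Type*) [Field K] : Type _ := ℙ K (Fin 3 → K)

/-- A line of `PG(2,q³)`: a two-dimensional vector subspace. -/
def IsLine {K : Type*} [Field K] (L : Submodule K (Fin 3 → K)) : Prop :=
  Module.finrank K L = 2

/-- The set of points on a line (subspace) of `PG(2,q³)`. -/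
def pointsOn {K : Type*} [Field K] (L : Submodule K (Fin 3 → K)) : Set (PG2 K) :=
  {X | X.submodule ≤ L}

/-- The line at infinity `z = 0` of `PG(2,q³)`. -/
def lineAtInfinity (K : Type*) [Field K] : Submodule K (Fin 3 → K) :=
  LinearMap.ker (LinearMap.proj (2 : Fin 3) : (Fin 3 → K) →ₗ[K] K)

/-- The canonical subplane `PG(2,q)` of `PG(2,q³)`: the points that have a coordinate vector with
entries in `F = GF(q)`. -/
def canonicalSubplane (F K : Type*) [Field F] [Field K] [Algebra F K] : Set (PG2 K) :=
  {X | ∃ v : Fin 3 → F, X.submodule = Submodule.span K {fun i => algebraMap F K (v i)}}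

/-- An order-`q`-subplane of `PG(2,q³)`: an image of `PG(2,q)` under an element of
`PGL(3,q³)`. -/
def IsSubplane (F : Type*) {K : Type*} [Field F] [Field K] [Algebra F K]
    (B : Set (PG2 K)) : Prop :=
  ∃ e : (Fin 3 → K) ≃ₗ[K] (Fin 3 → K),
    B = Projectivization.map e.toLinearMap e.injective '' canonicalSubplane F K

/-- `L` is a line of `PG(2,q³)` that extends a line of the subplane `B`. -/
def IsExtendedLine {K : Type*} [Field K] (B : Set (PG2 K))
    (L : Submodule K (Fin 3 → K)) : Prop :=
  IsLine L ∧ (B ∩ pointsOn L).Nontrivial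

/-- `ℓ` is a line of the subplane `B`, as a set of points (an order-`q`-subline of `B`). -/
def IsSublineOf {K : Type*} [Field K] (B ℓ : Set (PG2 K)) : Prop :=
  ∃ L, IsExtendedLine B L ∧ ℓ = B ∩ pointsOn L

/-- For a point `P` of `B`, the points in which the lines of `B` through `P` (extended to
`PG(2,q³)`) meet the line at infinity. -/
def directionsAt {K : Type*} [Field K] (B : Set (PG2 K)) (P : PG2 K) : Set (PG2 K) :=
  {X | X ∈ pointsOn (lineAtInfinity K) ∧
    ∃ L, IsExtendedLine B L ∧ P ∈ pointsOn L ∧ X ∈ pointsOn L}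

/-- `D` is the tangent subspace `P^⊥` of the subplane `B`, which is tangent to the line at
infinity at `T`: an order-`q`-subplane that contains the subline `directionsAt B P` of the line at
infinity and the subline `PT ∩ B`. -/
def IsTangentSubspace (F : Type*) {K : Type*} [Field F] [Field K] [Algebra F K]
    (B : Set (PG2 K)) (T P : PG2 K) (D : Set (PG2 K)) : Prop :=
  IsSubplane F D ∧ directionsAt B P ⊆ D ∧ B ∩ pointsOn (P.submodule ⊔ T.submodule) ⊆ D

end Plane

section Space

/-- Coordinate vectors `((x₀,x₁,x₂),(y₀,y₁,y₂),z)` of `PG(6,q)`. Points, lines, planes and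
3-spaces of `PG(6,q)` are subspaces of dimension 1, 2, 3, 4. -/
abbrev V7 (F : Type*) : Type _ := (Fin 3 → F) × (Fin 3 → F) × F

/-- The hyperplane at infinity `z = 0` of `PG(6,q)`. -/
def hyperplaneAtInfinity (F : Type*) [Field F] : Submodule F (V7 F) :=
  LinearMap.ker ((LinearMap.snd F (Fin 3 → F) F).comp
    (LinearMap.snd F (Fin 3 → F) ((Fin 3 → F) × F)))

variable {F K : Type*} [Field F] [Field K] [Algebra F K]

/-- The inverse of the generalised Bruck-Bose map `σ`: for an `F`-basis `b` of `K`
(for instance `1, τ, τ²`), the vector `((x₀,x₁,x₂),(y₀,y₁,y₂),z)` is sent to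
`(∑ xᵢ bᵢ, ∑ yᵢ bᵢ, z)`. -/
noncomputable def unsigma (b : Module.Basis (Fin 3) F K) : V7 F →ₗ[F] (Fin 3 → K) where
  toFun w := ![∑ i, w.1 i • b i, ∑ i, w.2.1 i • b i, algebraMap F K w.2.2]
  map_add' u v := by
    ext i
    fin_cases i <;> simp [add_smul, Finset.sum_add_distrib]
  map_smul' r u := by
    ext i
    fin_cases i <;> simp [Algebra.smul_def, Finset.mul_sum, mul_assoc]

/-- The subspace `[X]` of `PG(6,q)` that represents the point `X` of `PG(2,q³)`: all vectors
`w` such that `unsigma b w` is a multiple of the coordinate vector of `X`.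
If `X = (α,β,1)` is affine, this is the point `σ(α,β,1)` (see `bruckBose_affine`). If
`X = (α,β,0)` is at infinity, it is the plane of all points `σ(lα,lβ,0)`, `l ∈ K`, the element
of the regular spread that corresponds to `X`. -/
noncomputable def bruckBose (b : Module.Basis (Fin 3) F K) (X : PG2 K) : Submodule F (V7 F) :=
  (X.submodule.restrictScalars F).comap (unsigma b)

theorem bruckBose_affine (b : Module.Basis (Fin 3) F K) (α β : K) (X : PG2 K)
    (hX : X.submodule = Submodule.span K {![α, β, 1]}) :
    bruckBose b X = Submodule.span F {(b.equivFun α, b.equivFun β, 1)} := by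
  ext w
  obtain ⟨x, y, z⟩ := w
  simp only [bruckBose, Submodule.mem_comap, Submodule.restrictScalars_mem, hX,
    Submodule.mem_span_singleton]
  constructor
  · rintro ⟨l, hl⟩
    have h2 : l = algebraMap F K z := by simpa [unsigma] using congrFun hl 2
    subst h2
    have h0 : z • α = ∑ i, x i • b i := by
      simpa [unsigma, Algebra.smul_def] using congrFun hl 0
    have h1 : z • β = ∑ i, y i • b i := by
      simpa [unsigma, Algebra.smul_def] using congrFun hl 1
    refine ⟨z, ?_⟩
    rw [Prod.smul_mk, Prod.smul_mk, ← map_smul, ← map_smul, h0, h1,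
      ← b.equivFun_symm_apply, ← b.equivFun_symm_apply, LinearEquiv.apply_symm_apply,
      LinearEquiv.apply_symm_apply, smul_eq_mul, mul_one]
  · rintro ⟨z', hz⟩
    simp only [Prod.smul_mk, Prod.mk.injEq, smul_eq_mul, mul_one] at hz
    obtain ⟨rfl, rfl, rfl⟩ := hz
    refine ⟨algebraMap F K z', ?_⟩
    have key : ∀ γ : K, ∑ i, (z' • b.equivFun γ) i • b i = algebraMap F K z' * γ := by
      intro γ
      rw [← map_smul, b.sum_equivFun, Algebra.smul_def]
    ext i
    fin_cases i
    · exact (key α).symm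
    · exact (key β).symm
    · exact mul_one _

/-- The plane `π` of `PG(6,q)` represents the set `D` of points of `PG(2,q³)` (an
order-`q`-subplane secant to the line at infinity): `π` is not at infinity, its affine points are
those that correspond to the affine points of `D`, and the spread elements that it meets are those
that correspond to the points of `D` at infinity. -/
def IsPlaneOf (b : Module.Basis (Fin 3) F K) (D : Set (PG2 K))
    (π : Submodule F (V7 F)) : Prop :=
  Module.finrank F π = 3 ∧ ¬ π ≤ hyperplaneAtInfinity F ∧
    (∀ X ∉ pointsOn (lineAtInfinity K), X ∈ D ↔ bruckBose b X ≤ π) ∧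
    (∀ X ∈ pointsOn (lineAtInfinity K), X ∈ D ↔ bruckBose b X ⊓ π ≠ ⊥)

/-- The extension of a vector of `PG(6,q)` to `PG(6,q³)`. -/
def extend (K : Type*) [Field K] [Algebra F K] (w : V7 F) : V7 K :=
  (fun i => algebraMap F K (w.1 i), fun i => algebraMap F K (w.2.1 i), algebraMap F K w.2.2)

/-- The conjugate of a vector of `PG(6,q³)` under an element of the Galois group of `K/F`, that is,
under `x ↦ x`, `x ↦ x^q` or `x ↦ x^(q²)`. -/
def conjugate (φ : K ≃ₐ[F] K) (w : V7 K) : V7 K :=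
  (fun i => φ (w.1 i), fun i => φ (w.2.1 i), φ w.2.2)

/-- The transversal line `g` of the regular spread, in `PG(6,q³)`. Multiplication by `a ∈ K` acts
on each of the two coordinate triples by its matrix with respect to `b`, and fixes each element of
the spread; `g` consists of the vectors at infinity on which it acts, for each `a`, as the
scalar `a`. For the basis `1, τ, τ²` with `τ³ = t₂τ² + t₁τ + t₀`, the line `g` joins
`(t₁ + t₂τ - τ², t₂ - τ, -1, 0, 0, 0, 0)` and `(0, 0, 0, t₁ + t₂τ - τ², t₂ - τ, -1, 0)`. -/
def transversal (b : Module.Basis (Fin 3) F K) : Set (V7 K) :=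
  {w | w.2.2 = 0 ∧ ∀ a : K,
    ((Algebra.leftMulMatrix b a).map (algebraMap F K)).mulVec w.1 = a • w.1 ∧
    ((Algebra.leftMulMatrix b a).map (algebraMap F K)).mulVec w.2.1 = a • w.2.1}

/-- The vector with parameters `(s,t)` on the cubic curve with coefficient vectors `c`. -/
def cubic {R W : Type*} [Field R] [AddCommGroup W] [Module R W] (c : Fin 4 → W) (s t : R) : W :=
  s ^ 3 • c 0 + (s ^ 2 * t) • c 1 + (s * t ^ 2) • c 2 + t ^ 3 • c 3

/-- The tangent line to the cubic at parameters `(s,t)`: the span of the point and of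
the two partial derivatives of the parametrization. -/
def cubicTangent {R W : Type*} [Field R] [AddCommGroup W] [Module R W] (c : Fin 4 → W)
    (s t : R) : Submodule R W :=
  Submodule.span R {cubic c s t,
    (3 * s ^ 2) • c 0 + (2 * s * t) • c 1 + t ^ 2 • c 2,
    s ^ 2 • c 1 + (2 * s * t) • c 2 + (3 * t ^ 2) • c 3}

/-- The curve parametrized by `c` is a special twisted cubic: a twisted cubic (the coefficient
vectors are linearly independent) in a 3-space that is not at infinity and contains a spread
element, whose extension to `PG(6,q³)` meets the transversals `g, g^q, g^(q²)` of the spread. -/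
def IsSpecialTwistedCubic (b : Module.Basis (Fin 3) F K) (c : Fin 4 → V7 F) : Prop :=
  LinearIndependent F c ∧
    ¬ Submodule.span F (Set.range c) ≤ hyperplaneAtInfinity F ∧
    (∃ X ∈ pointsOn (lineAtInfinity K), bruckBose b X ≤ Submodule.span F (Set.range c)) ∧
    ∀ φ : K ≃ₐ[F] K, ∃ s t : K, (s, t) ≠ (0, 0) ∧
      ∃ w ∈ transversal b, cubic (fun i => extend K (c i)) s t = conjugate φ w

/-- The set of points of `PG(6,q)` on the curve parametrized by `c`. -/
def cubicPoints (c : Fin 4 → V7 F) : Set (Submodule F (V7 F)) :=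
  {S | ∃ s t : F, (s, t) ≠ (0, 0) ∧ S = Submodule.span F {cubic c s t}}

/-- `I` is the point `I_{P,ℓ}`: the point in which the tangent line at `P` to the special twisted
cubic `[ℓ]` meets the hyperplane at infinity. -/
def IsTangentPointAtInfinity (b : Module.Basis (Fin 3) F K) (ℓ : Set (PG2 K)) (P : PG2 K)
    (I : Submodule F (V7 F)) : Prop :=
  Module.finrank F I = 1 ∧
    ∃ c : Fin 4 → V7 F, IsSpecialTwistedCubic b c ∧ cubicPoints c = bruckBose b '' ℓ ∧
      ∃ s t : F, (s, t) ≠ (0, 0) ∧ bruckBose b P = Submodule.span F {cubic c s t} ∧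
        I = cubicTangent c s t ⊓ hyperplaneAtInfinity F

/-- `J` is the line `I_P`: a line that contains the points `I_{P,ℓ}` for all lines `ℓ` of `B`
through `P` and not through `T`. -/
def IsLineIP (b : Module.Basis (Fin 3) F K) (B : Set (PG2 K)) (T P : PG2 K)
    (J : Submodule F (V7 F)) : Prop :=
  Module.finrank F J = 2 ∧
    ∀ ℓ, IsSublineOf B ℓ → P ∈ ℓ → T ∉ ℓ →
      ∀ I, IsTangentPointAtInfinity b ℓ P I → I ≤ J

end Space

end BruckBose

open BruckBose

/-! A subplane is the set of points with a coordinate vector in the `F`-span of a `K`-basis of `K³`.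
For `B` this basis can be taken as `v₀, v₁, v₂` with `v₀` on `P` and last coordinate 1, `v₁` on `T`
with last coordinate 0, and `v₂` with last coordinate `τ ∉ F` (`exists_isFrame`). The lines of `B`
through `P` and not through `T` then come from `v₀` and `r = v₂ + k v₁`, `k ∈ F`.

The map `unsigma` identifies `V7 F` with the vectors whose last coordinate lies in `F`. The point `s
v₀ + t r` has last coordinate `s + tτ`; multiplied by the cofactor `n(s,t)` of this factor in its
norm, it becomes a point of a cubic over `F`, and the zeros of the conjugates of `n` put this cubic
on the transversals. Conversely, the `K`-linear extension of `unsigma` vanishes on the two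
transversals other than `g`, so every special twisted cubic becomes a quadratic form times a line
parametrization `s e₀ + t e₁` (`IsSpecialTwistedCubic.exists_isLineMul`). In such a product the
derivative of the quadratic form does not affect where the tangent meets infinity. If the curve
carries the points of `ℓ`, comparing parametrizations gives the vector `r - τ v₀`, up to a factor in
`F`, whichever special cubic was chosen.

Thus `I_{P,ℓ}` is given by `k v₁ + (v₂ - τ v₀)`, and these points lie on the line of `v₁` and `v₂ -
τ v₀`, which is already determined by `k = 0, 1`. The same vectors together with `v₀` span an
`F`-form of `P^⊥`: the required sublines fix their relative scalars
(`smul_mem_span_of_smul_add_mem`). All last coordinates in this form are in `F`, so its preimage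
under `unsigma` is a plane, visibly the join of `P` and `I_P`. -/

namespace BruckBose

/-! ### Points and subplanes in terms of coordinate vectors. -/

section Points

variable {F K : Type*} [Field F] [Field K] [Algebra F K]

theorem submodule_eq_span {X : PG2 K} {w : Fin 3 → K} (hw : w ≠ 0) (h : w ∈ X.submodule) :
    X.submodule = Submodule.span K {w} := by
  induction X using Projectivization.ind with
  | h v hv =>
    rw [Projectivization.submodule_mk] at h ⊢
    obtain ⟨a, rfl⟩ := Submodule.mem_span_singleton.1 h
    have ha : a ≠ 0 := by rintro rfl; simp at hw
    rw [Submodule.span_singleton_smul_eq (IsUnit.mk0 a ha)]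

theorem point_eq {X Y : PG2 K} {w : Fin 3 → K} (hw : w ≠ 0) (hX : w ∈ X.submodule)
    (hY : w ∈ Y.submodule) : X = Y :=
  Projectivization.submodule_injective
    ((submodule_eq_span hw hX).trans (submodule_eq_span hw hY).symm)

theorem exists_point {w : Fin 3 → K} (hw : w ≠ 0) : ∃ X : PG2 K, w ∈ X.submodule :=
  ⟨Projectivization.mk K w hw, by
    rw [Projectivization.submodule_mk]; exact Submodule.mem_span_singleton_self w⟩

theorem exists_mem_submodule (X : PG2 K) : ∃ w : Fin 3 → K, w ≠ 0 ∧ w ∈ X.submodule :=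
  ⟨X.rep, X.rep_nonzero, by
    rw [Projectivization.submodule_eq]; exact Submodule.mem_span_singleton_self _⟩

theorem mem_pointsOn {X : PG2 K} {w : Fin 3 → K} (hw : w ≠ 0) (h : w ∈ X.submodule)
    (L : Submodule K (Fin 3 → K)) : X ∈ pointsOn L ↔ w ∈ L := by
  change X.submodule ≤ L ↔ _
  rw [submodule_eq_span hw h, Submodule.span_singleton_le_iff_mem]

theorem mem_lineAtInfinity {w : Fin 3 → K} : w ∈ lineAtInfinity K ↔ w 2 = 0 := Iff.rfl

/-- The points of `PG(2,q³)` that have a coordinate vector in `W`. -/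
def formPoints (W : Submodule F (Fin 3 → K)) : Set (PG2 K) :=
  {X | ∃ w ∈ W, w ≠ 0 ∧ w ∈ X.submodule}

theorem map_mem_submodule (e : (Fin 3 → K) ≃ₗ[K] (Fin 3 → K)) (X : PG2 K) {w : Fin 3 → K}
    (h : w ∈ X.submodule) :
    e w ∈ (Projectivization.map e.toLinearMap e.injective X).submodule := by
  induction X using Projectivization.ind with
  | h v hv =>
    rw [Projectivization.submodule_mk] at h
    rw [Projectivization.map_mk, Projectivization.submodule_mk]
    obtain ⟨a, rfl⟩ := Submodule.mem_span_singleton.1 h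
    rw [map_smul]
    exact Submodule.smul_mem _ _ (Submodule.mem_span_singleton_self _)

theorem image_canonicalSubplane (e : (Fin 3 → K) ≃ₗ[K] (Fin 3 → K)) :
    Projectivization.map e.toLinearMap e.injective '' canonicalSubplane F K =
      formPoints (Submodule.span F (Set.range fun i => e (Pi.single i 1))) := by
  have key : ∀ a : Fin 3 → F, e (fun i => algebraMap F K (a i)) =
      ∑ i, a i • e (Pi.single i 1) := by
    intro a
    have : (fun i => algebraMap F K (a i)) =
        ∑ i, algebraMap F K (a i) • (Pi.single i 1 : Fin 3 → K) := by
      ext j; simp [Finset.sum_apply, Pi.single_apply, -algebraMap_smul]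
    rw [this, map_sum]
    exact Finset.sum_congr rfl fun i _ => by rw [map_smul, algebraMap_smul]
  ext X
  constructor
  · rintro ⟨Y, ⟨a, ha⟩, rfl⟩
    have hmem : (fun i => algebraMap F K (a i)) ∈ Y.submodule := by
      rw [ha]; exact Submodule.mem_span_singleton_self _
    have hne : (fun i => algebraMap F K (a i)) ≠ 0 := by
      intro h
      obtain ⟨w, hw, hwY⟩ := exists_mem_submodule Y
      rw [ha, h] at hwY
      simp at hwY
      exact hw hwY
    refine ⟨e (fun i => algebraMap F K (a i)), ?_, by simpa using hne, map_mem_submodule e Y hmem⟩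
    rw [key]
    exact Submodule.sum_mem _ fun i _ => Submodule.smul_mem _ _ (Submodule.subset_span ⟨i, rfl⟩)
  · rintro ⟨w, hw, hw0, hwX⟩
    obtain ⟨a, rfl⟩ := (Submodule.mem_span_range_iff_exists_fun F).1 hw
    rw [← key] at hw0 hwX
    have hne : (fun i => algebraMap F K (a i)) ≠ 0 := by
      intro h; rw [h] at hw0; simp at hw0
    obtain ⟨Y, hY⟩ := exists_point hne
    exact ⟨Y, ⟨a, submodule_eq_span hne hY⟩, point_eq hw0 (map_mem_submodule e Y hY) hwX⟩

/-- Replaces projectivities by the images of the standard basis, so that subplanes can be handled as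
`F`-spans. -/
theorem isSubplane_iff {B : Set (PG2 K)} : IsSubplane F B ↔
    ∃ v : Fin 3 → Fin 3 → K, LinearIndependent K v ∧
      B = formPoints (Submodule.span F (Set.range v)) := by
  constructor
  · rintro ⟨e, rfl⟩
    refine ⟨fun i => e (Pi.single i 1), ?_, image_canonicalSubplane e⟩
    have h := (Pi.basisFun K (Fin 3)).linearIndependent.map' e.toLinearMap
      (LinearMap.ker_eq_bot.2 e.injective)
    have he : (fun i => e (Pi.single i 1)) = e.toLinearMap ∘ Pi.basisFun K (Fin 3) := by
      funext i; simp
    rw [he]; exact h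
  · rintro ⟨v, hv, rfl⟩
    let bv := basisOfLinearIndependentOfCardEqFinrank hv (by simp)
    refine ⟨(Pi.basisFun K (Fin 3)).equiv bv (Equiv.refl _), ?_⟩
    rw [image_canonicalSubplane]
    congr 3
    funext i
    have := (Pi.basisFun K (Fin 3)).equiv_apply (b' := bv) (e := Equiv.refl _) (i := i)
    rw [Pi.basisFun_apply] at this
    rw [this]; simp [bv]

end Points

/-! ### The Bruck–Bose map as an injective `F`-linear map. -/

section Unsigma

variable {F K : Type*} [Field F] [Field K] [Algebra F K] (b : Module.Basis (Fin 3) F K)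

theorem unsigma_apply_two (w : V7 F) : unsigma b w 2 = algebraMap F K w.2.2 := rfl

theorem unsigma_apply_zero (w : V7 F) : unsigma b w 0 = ∑ i, w.1 i • b i := rfl

theorem unsigma_apply_one (w : V7 F) : unsigma b w 1 = ∑ i, w.2.1 i • b i := rfl

theorem unsigma_injective : Function.Injective (unsigma b) := by
  have key : ∀ x : Fin 3 → F, ∑ i, x i • b i = b.equivFun.symm x := fun x =>
    (b.equivFun_symm_apply x).symm
  rintro ⟨x, y, z⟩ ⟨x', y', z'⟩ h
  have h0 := congrFun h 0
  have h1 := congrFun h 1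
  have h2 := congrFun h 2
  rw [unsigma_apply_zero, unsigma_apply_zero, key, key] at h0
  rw [unsigma_apply_one, unsigma_apply_one, key, key] at h1
  rw [unsigma_apply_two, unsigma_apply_two] at h2
  have e0 : x = x' := b.equivFun.symm.injective h0
  have e1 : y = y' := b.equivFun.symm.injective h1
  have e2 : z = z' := (algebraMap F K).injective h2
  rw [e0, e1, e2]

theorem exists_unsigma_eq (u : Fin 3 → K) (z : F) (hu : u 2 = algebraMap F K z) :
    ∃ w : V7 F, unsigma b w = u ∧ w.2.2 = z := by
  refine ⟨(b.equivFun (u 0), b.equivFun (u 1), z), ?_, rfl⟩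
  ext i
  fin_cases i
  · exact b.sum_equivFun (u 0)
  · exact b.sum_equivFun (u 1)
  · exact hu.symm

theorem mem_hyperplaneAtInfinity {w : V7 F} : w ∈ hyperplaneAtInfinity F ↔ w.2.2 = 0 := Iff.rfl

theorem mem_bruckBose {X : PG2 K} {w : V7 F} : w ∈ bruckBose b X ↔ unsigma b w ∈ X.submodule :=
  Iff.rfl

theorem bruckBose_eq_span {X : PG2 K} {w : V7 F} (hw : w.2.2 ≠ 0)
    (h : unsigma b w ∈ X.submodule) : bruckBose b X = Submodule.span F {w} := by
  have hz : algebraMap F K w.2.2 ≠ 0 := by simpa using hw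
  have hne : unsigma b w ≠ 0 := fun h0 => hz (congrFun h0 2)
  ext u
  rw [mem_bruckBose, submodule_eq_span hne h, Submodule.mem_span_singleton,
    Submodule.mem_span_singleton]
  constructor
  · rintro ⟨l, hl⟩
    refine ⟨u.2.2 / w.2.2, unsigma_injective b ?_⟩
    have h2 : l * algebraMap F K w.2.2 = algebraMap F K u.2.2 := congrFun hl 2
    rw [map_smul, ← hl, ← algebraMap_smul K, map_div₀, ← h2, mul_div_cancel_right₀ _ hz]
  · rintro ⟨a, rfl⟩
    exact ⟨algebraMap F K a, by rw [map_smul, algebraMap_smul]⟩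

/-- The hypothesis says exactly that `W` lies in the range of the injective map `unsigma b`. -/
theorem finrank_comap_unsigma {W : Submodule F (Fin 3 → K)}
    (hW : ∀ u ∈ W, ∃ z : F, u 2 = algebraMap F K z) :
    Module.finrank F (W.comap (unsigma b)) = Module.finrank F W := by
  have hle : W ≤ LinearMap.range (unsigma b) := fun u hu => by
    obtain ⟨z, hz⟩ := hW u hu
    obtain ⟨w, hw, -⟩ := exists_unsigma_eq b u z hz
    exact ⟨w, hw⟩
  have h := LinearEquiv.finrank_eq
    (Submodule.equivMapOfInjective _ (unsigma_injective b) (W.comap (unsigma b)))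
  rwa [Submodule.map_comap_eq_of_le hle] at h

end Unsigma

/-! ### Conjugates of the Bruck–Bose map, and the transversals as their zeros. -/

section Conjugates

variable {F K : Type*} [Field F] [Field K] [Algebra F K] (b : Module.Basis (Fin 3) F K)

/-- The `K`-linear extension to `PG(6,q³)` of the conjugate of `unsigma b` under `ψ`. -/
noncomputable def conjForm (ψ : K ≃ₐ[F] K) : V7 K →ₗ[K] (Fin 3 → K) where
  toFun w := ![∑ i, w.1 i * ψ (b i), ∑ i, w.2.1 i * ψ (b i), w.2.2]
  map_add' u v := by
    ext i
    fin_cases i <;> simp [add_mul, Finset.sum_add_distrib]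
  map_smul' r u := by
    ext i
    fin_cases i <;> simp [Finset.mul_sum, mul_assoc]

/-- Taking coordinates of the coefficients with respect to `b` splits a `K`-relation between vectors
over `F` into three `F`-relations. -/
theorem eq_zero_of_sum_smul_extend (b : Module.Basis (Fin 3) F K) {ι : Type*} [Fintype ι]
    {c : ι → V7 F}
    (hc : LinearIndependent F c) {m : ι → K} (h : ∑ i, m i • extend K (c i) = 0) : m = 0 := by
  have hcoord : ∀ k i, b.coord k (m i) = 0 := by
    intro k
    refine Fintype.linearIndependent_iff.1 hc _ ?_
    have hk : ∀ x : ι → F, ∑ i, m i * algebraMap F K (x i) = 0 →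
        ∑ i, b.coord k (m i) * x i = 0 := by
      intro x hx
      rw [← map_zero (b.coord k), ← hx, map_sum]
      refine Finset.sum_congr rfl fun i _ => ?_
      rw [mul_comm (m i), ← Algebra.smul_def, map_smul, smul_eq_mul, mul_comm]
    refine Prod.ext ?_ (Prod.ext ?_ ?_)
    · ext j
      have := congrFun (congrArg Prod.fst h) j
      simpa [Prod.fst_sum, Finset.sum_apply] using
        hk (fun i => (c i).1 j) (by simpa [Prod.fst_sum, Finset.sum_apply, extend] using this)
    · ext j
      have := congrFun (congrArg (fun v => v.2.1) h) j
      simpa [Prod.fst_sum, Prod.snd_sum, Finset.sum_apply] using hk (fun i => (c i).2.1 j)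
        (by simpa [Prod.fst_sum, Prod.snd_sum, Finset.sum_apply, extend] using this)
    · have := congrArg (fun v => v.2.2) h
      simpa [Prod.snd_sum] using
        hk (fun i => (c i).2.2) (by simpa [Prod.snd_sum, extend] using this)
  funext i
  exact b.ext_elem fun k => by simpa using hcoord k i

theorem cubic_extend_ne_zero (b : Module.Basis (Fin 3) F K) {c : Fin 4 → V7 F}
    (hc : LinearIndependent F c) {s t : K} (hst : (s, t) ≠ (0, 0)) :
    cubic (fun i => extend K (c i)) s t ≠ 0 := by
  intro h
  have h0 := eq_zero_of_sum_smul_extend b hc (m := ![s ^ 3, s ^ 2 * t, s * t ^ 2, t ^ 3])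
    (by simpa [Fin.sum_univ_four, cubic] using h)
  have hs : s ^ 3 = 0 := congrFun h0 0
  have ht : t ^ 3 = 0 := congrFun h0 3
  exact hst (by simp_all)

theorem conjForm_extend (ψ : K ≃ₐ[F] K) (w : V7 F) :
    conjForm b ψ (extend K w) = fun i => ψ (unsigma b w i) := by
  ext i
  fin_cases i <;> simp [conjForm, extend, unsigma, Algebra.smul_def]

theorem conjForm_conjugate (φ ψ : K ≃ₐ[F] K) (w : V7 K) :
    conjForm b ψ (conjugate φ w) = fun i => φ (conjForm b (φ⁻¹ * ψ) w i) := by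
  ext i
  fin_cases i <;> simp [conjForm, conjugate, map_sum]

/-- The row `(ψ (b i))` is a left eigenvector of the matrix of multiplication by `a`, with
eigenvalue `ψ a`. -/
theorem sum_leftMulMatrix_mulVec (ψ : K ≃ₐ[F] K) (a : K) (x : Fin 3 → K) :
    ∑ i, (((Algebra.leftMulMatrix b a).map (algebraMap F K)).mulVec x) i * ψ (b i) =
      ψ a * ∑ i, x i * ψ (b i) := by
  have h : ∀ j, ∑ i, algebraMap F K (Algebra.leftMulMatrix b a i j) * ψ (b i) =
      ψ a * ψ (b j) := by
    intro j
    conv_rhs => rw [← map_mul ψ, ← b.sum_repr (a * b j), map_sum]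
    refine Finset.sum_congr rfl fun i _ => ?_
    rw [Algebra.leftMulMatrix_eq_repr_mul, Algebra.smul_def, map_mul ψ, AlgEquiv.commutes]
  simp only [Matrix.mulVec, dotProduct, Matrix.map_apply, Finset.sum_mul]
  rw [Finset.sum_comm, Finset.mul_sum]
  refine Finset.sum_congr rfl fun j _ => ?_
  rw [mul_left_comm, ← h j, Finset.mul_sum]
  exact Finset.sum_congr rfl fun i _ => by ring

/-- Weighting the equations by `ψ (b j)` and summing over `ψ` gives the trace matrix applied to `x`;
this matrix is invertible because `K/F` is separable. -/
theorem eq_zero_of_sum_conj [IsGalois F K] {x : Fin 3 → K}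
    (h : ∀ ψ : K ≃ₐ[F] K, ∑ i, x i * ψ (b i) = 0) : x = 0 := by
  have : FiniteDimensional F K := b.finiteDimensional_of_finite
  have hdet : ((Algebra.traceMatrix F b).map (algebraMap F K)).det ≠ 0 := by
    have h1 := Algebra.discr_not_zero_of_basis F b
    rw [Algebra.discr_def] at h1
    rw [← RingHom.mapMatrix_apply, ← RingHom.map_det]
    simpa using h1
  refine Matrix.eq_zero_of_mulVec_eq_zero hdet ?_
  ext j
  simp only [Matrix.mulVec, dotProduct, Matrix.map_apply, Algebra.traceMatrix_apply,
    Algebra.traceForm_apply, trace_eq_sum_automorphisms, Finset.sum_mul, Pi.zero_apply]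
  rw [Finset.sum_comm]
  refine Finset.sum_eq_zero fun ψ _ => ?_
  calc ∑ i, ψ (b j * b i) * x i = ψ (b j) * ∑ i, x i * ψ (b i) := by
        rw [Finset.mul_sum]
        exact Finset.sum_congr rfl fun i _ => by rw [map_mul]; ring
    _ = 0 := by rw [h ψ, mul_zero]

theorem eq_zero_of_conjForm_eq_zero [IsGalois F K] {w : V7 K}
    (h : ∀ ψ : K ≃ₐ[F] K, conjForm b ψ w = 0) : w = 0 := by
  obtain ⟨x, y, z⟩ := w
  have hx : x = 0 := eq_zero_of_sum_conj b fun ψ => congrFun (h ψ) 0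
  have hy : y = 0 := eq_zero_of_sum_conj b fun ψ => congrFun (h ψ) 1
  have hz : z = 0 := congrFun (h 1) 2
  rw [hx, hy, hz]; rfl

/-- A right eigenvector for `a` and a left eigenvector for `ψ a` pair to zero when `ψ a ≠ a`. -/
theorem conjForm_eq_zero_of_mem_transversal {w : V7 K} (hw : w ∈ transversal b)
    {ψ : K ≃ₐ[F] K} (hψ : ψ ≠ 1) : conjForm b ψ w = 0 := by
  obtain ⟨a, ha⟩ : ∃ a, ψ a ≠ a := by
    by_contra! h
    exact hψ (AlgEquiv.ext h)
  obtain ⟨hz, hw⟩ := hw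
  have key : ∀ x : Fin 3 → K,
      ((Algebra.leftMulMatrix b a).map (algebraMap F K)).mulVec x = a • x →
      ∑ i, x i * ψ (b i) = 0 := by
    intro x hx
    have h := sum_leftMulMatrix_mulVec b ψ a x
    rw [hx] at h
    simp only [Pi.smul_apply, smul_eq_mul, mul_assoc] at h
    rw [← Finset.mul_sum, ← sub_eq_zero, ← sub_mul] at h
    exact (mul_eq_zero.1 h).resolve_left (sub_ne_zero.2 ha.symm)
  ext i
  fin_cases i
  · exact key _ (hw a).1
  · exact key _ (hw a).2
  · exact hz

/-- The eigenvector equation may be tested against every row `(ψ (b i))`: it is automatic for `ψ =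
1`, and for the others both sides vanish. -/
theorem mem_transversal_of_conjForm [IsGalois F K] {w : V7 K} (hz : w.2.2 = 0)
    (h : ∀ ψ : K ≃ₐ[F] K, ψ ≠ 1 → conjForm b ψ w = 0) : w ∈ transversal b := by
  have key : ∀ (a : K) (x : Fin 3 → K), (∀ ψ : K ≃ₐ[F] K, ψ ≠ 1 → ∑ i, x i * ψ (b i) = 0) →
      ((Algebra.leftMulMatrix b a).map (algebraMap F K)).mulVec x = a • x := by
    intro a x hx
    rw [← sub_eq_zero]
    refine eq_zero_of_sum_conj b fun ψ => ?_
    simp only [Pi.sub_apply, sub_mul, Finset.sum_sub_distrib, sum_leftMulMatrix_mulVec,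
      Pi.smul_apply, smul_eq_mul, mul_assoc]
    rw [← Finset.mul_sum, ← sub_mul]
    by_cases hψ : ψ = 1
    · simp [hψ]
    · rw [hx ψ hψ, mul_zero]
  exact ⟨hz, fun a => ⟨key a _ fun ψ hψ => congrFun (h ψ hψ) 0,
    key a _ fun ψ hψ => congrFun (h ψ hψ) 1⟩⟩

end Conjugates

/-! ### The cyclic Galois group of order three. -/

section Galois

variable {F K : Type*} [Field F] [Field K] [Algebra F K]

theorem exists_galois_generator [IsGalois F K] (h3 : Module.finrank F K = 3) :
    ∃ φ : K ≃ₐ[F] K, φ ≠ 1 ∧ φ ^ 3 = 1 ∧ ∀ ψ : K ≃ₐ[F] K, ψ = 1 ∨ ψ = φ ∨ ψ = φ ^ 2 := by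
  have hfin : FiniteDimensional F K := Module.finite_of_finrank_pos (by omega)
  have hcard : Nat.card (K ≃ₐ[F] K) = 3 := by rw [IsGalois.card_aut_eq_finrank, h3]
  have : Fact (Nat.Prime 3) := ⟨Nat.prime_three⟩
  have hnt : Nontrivial (K ≃ₐ[F] K) := Finite.one_lt_card_iff_nontrivial.1 (by omega)
  obtain ⟨φ, hφ⟩ := exists_ne (1 : K ≃ₐ[F] K)
  classical
  refine ⟨φ, hφ, hcard ▸ pow_card_eq_one', fun ψ => ?_⟩
  have hord : orderOf φ = 3 := orderOf_eq_prime (hcard ▸ pow_card_eq_one') hφ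
  have hψ : ψ ∈ Submonoid.powers φ := by
    rw [mem_powers_iff_mem_zpowers]
    exact mem_zpowers_of_prime_card hcard hφ
  rw [mem_powers_iff_mem_range_orderOf, hord] at hψ
  obtain ⟨k, hk, rfl⟩ := Finset.mem_image.1 hψ
  rw [Finset.mem_range] at hk
  interval_cases k <;> simp

theorem exists_algebraMap_eq [IsGalois F K] {φ : K ≃ₐ[F] K}
    (hφ : ∀ ψ : K ≃ₐ[F] K, ψ = 1 ∨ ψ = φ ∨ ψ = φ ^ 2) [FiniteDimensional F K] {x : K}
    (hx : φ x = x) : ∃ a : F, algebraMap F K a = x := by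
  refine (IsGalois.mem_range_algebraMap_iff_fixed x).2 fun ψ => ?_
  rcases hφ ψ with rfl | rfl | rfl
  · rfl
  · exact hx
  · rw [pow_two, AlgEquiv.mul_apply, hx, hx]

end Galois

/-! ### Factoring vector-valued binary cubics. -/

section Cubic

theorem cubic_algebraMap {F K W : Type*} [Field F] [Field K] [Algebra F K] [AddCommGroup W]
    [Module F W] [Module K W] [IsScalarTower F K W] (c : Fin 4 → W) (s t : F) :
    cubic c (algebraMap F K s) (algebraMap F K t) = cubic c s t := by
  simp only [cubic, ← map_pow, ← map_mul, algebraMap_smul]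

theorem map_cubic {R W W' : Type*} [Field R] [AddCommGroup W] [Module R W] [AddCommGroup W']
    [Module R W'] (f : W →ₗ[R] W') (c : Fin 4 → W) (s t : R) :
    f (cubic c s t) = cubic (fun i => f (c i)) s t := by
  simp only [cubic, map_add, map_smul]

/-- The cubic with coefficients `d` is the product of the quadratic form with coefficients
`n` and the parametrization `(s, t) ↦ s e₀ + t e₁` of a line. -/
structure IsLineMul {K : Type*} [Field K] (d : Fin 4 → Fin 3 → K) (n : Fin 3 → K)
    (e₀ e₁ : Fin 3 → K) : Prop where
  zero : d 0 = n 0 • e₀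
  one : d 1 = n 0 • e₁ + n 1 • e₀
  two : d 2 = n 1 • e₁ + n 2 • e₀
  three : d 3 = n 2 • e₁

/-- The quadratic form with coefficients `n`. -/
def quadratic {K : Type*} [Field K] (n : Fin 3 → K) (s t : K) : K :=
  n 0 * s ^ 2 + n 1 * (s * t) + n 2 * t ^ 2

theorem IsLineMul.cubic_eq {K : Type*} [Field K] {d : Fin 4 → Fin 3 → K} {n : Fin 3 → K}
    {e₀ e₁ : Fin 3 → K} (h : IsLineMul d n e₀ e₁) (s t : K) :
    cubic d s t = quadratic n s t • (s • e₀ + t • e₁) := by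
  simp only [cubic, quadratic, h.zero, h.one, h.two, h.three]
  module

/-- Division by the linear form `(S,T) ↦ t S - s T`, which vanishes at the given zero; `q` lists the
coefficients of the quotient. -/
theorem exists_cubic_factor {K : Type*} [Field K] {d : Fin 4 → Fin 3 → K} {s t : K}
    (hst : (s, t) ≠ (0, 0)) (h : cubic d s t = 0) :
    ∃ q : Fin 3 → Fin 3 → K, d 0 = t • q 0 ∧ d 1 = t • q 1 - s • q 0 ∧
      d 2 = t • q 2 - s • q 1 ∧ d 3 = -(s • q 2) := by
  by_cases ht : t = 0
  · subst ht
    have hs : s ≠ 0 := fun h0 => hst (by rw [h0])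
    have h0 : d 0 = 0 := by
      simpa [cubic, hs] using h
    refine ⟨![-(s⁻¹ • d 1), -(s⁻¹ • d 2), -(s⁻¹ • d 3)], ?_, ?_, ?_, ?_⟩ <;> simp [h0, hs]
  · refine ⟨![t⁻¹ • d 0, t⁻¹ • (d 1 + s • t⁻¹ • d 0),
      t⁻¹ • (d 2 + s • t⁻¹ • (d 1 + s • t⁻¹ • d 0))], ?_, ?_, ?_, ?_⟩
    · simp [ht]
    · simp [ht]
    · simp [ht]
    · ext i
      have hi := congrFun h i
      simp only [cubic, Pi.add_apply, Pi.smul_apply, smul_eq_mul, Pi.zero_apply] at hi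
      simp only [Matrix.cons_val, Pi.add_apply, Pi.smul_apply, smul_eq_mul, Pi.neg_apply]
      field_simp
      linear_combination hi

theorem exists_quadratic_factor {K : Type*} [Field K] {q : Fin 3 → Fin 3 → K} {s t : K}
    (hst : (s, t) ≠ (0, 0)) (h : s ^ 2 • q 0 + (s * t) • q 1 + t ^ 2 • q 2 = 0) :
    ∃ e₀ e₁ : Fin 3 → K, q 0 = t • e₀ ∧ q 1 = t • e₁ - s • e₀ ∧ q 2 = -(s • e₁) := by
  by_cases ht : t = 0
  · subst ht
    have hs : s ≠ 0 := fun h0 => hst (by rw [h0])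
    have h0 : q 0 = 0 := by
      simpa [hs] using h
    refine ⟨-(s⁻¹ • q 1), -(s⁻¹ • q 2), ?_, ?_, ?_⟩ <;> simp [h0, hs]
  · refine ⟨t⁻¹ • q 0, t⁻¹ • (q 1 + s • t⁻¹ • q 0), ?_, ?_, ?_⟩
    · simp [ht]
    · simp [ht]
    · ext i
      have hi := congrFun h i
      simp only [Pi.add_apply, Pi.smul_apply, smul_eq_mul, Pi.zero_apply] at hi
      simp only [Pi.add_apply, Pi.smul_apply, smul_eq_mul, Pi.neg_apply]
      field_simp
      linear_combination hi

theorem exists_isLineMul {K : Type*} [Field K] {d : Fin 4 → Fin 3 → K} {s t s' t' : K}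
    (h : cubic d s t = 0) (h' : cubic d s' t' = 0) (hne : t * s' - s * t' ≠ 0) :
    ∃ n e₀ e₁, IsLineMul d n e₀ e₁ := by
  obtain ⟨q, h0, h1, h2, h3⟩ := exists_cubic_factor (by rintro ⟨⟩; simp at hne) h
  obtain ⟨e₀, e₁, k0, k1, k2⟩ := exists_quadratic_factor (q := q) (s := s') (t := t')
    (by rintro ⟨⟩; simp at hne) (by
      have : (t * s' - s * t') • (s' ^ 2 • q 0 + (s' * t') • q 1 + t' ^ 2 • q 2) = 0 := by
        rw [← h', cubic, h0, h1, h2, h3]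
        module
      exact (smul_eq_zero.1 this).resolve_left hne)
  refine ⟨![t * t', -(t * s' + s * t'), s * s'], e₀, e₁, ?_, ?_, ?_, ?_⟩
  · rw [h0, k0]; simp only [Matrix.cons_val]; module
  · rw [h1, k1, k0]; simp only [Matrix.cons_val]; module
  · rw [h2, k2, k1]; simp only [Matrix.cons_val]; module
  · rw [h3, k2]; simp only [Matrix.cons_val]; module

end Cubic

/-! ### Special twisted cubics as quadratic form times line, and their tangents. -/

section SpecialCubic

variable {F K : Type*} [Field F] [Field K] [Algebra F K] {b : Module.Basis (Fin 3) F K}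

theorem conjForm_cubic_extend (ψ : K ≃ₐ[F] K) (c : Fin 4 → V7 F) (s t : K) :
    conjForm b ψ (cubic (fun i => extend K (c i)) s t) =
      cubic (fun i j => ψ (unsigma b (c i) j)) s t := by
  rw [map_cubic]
  simp only [conjForm_extend]

/-- The form `conjForm b 1` extends `unsigma b` and vanishes on the transversals conjugate to `g`
under `φ` and `φ ^ 2`. The parameters at which the curve meets these are two zeros of the cubic in
`K³`. -/
theorem IsSpecialTwistedCubic.exists_isLineMul [IsGalois F K] {c : Fin 4 → V7 F}
    (hc : IsSpecialTwistedCubic b c) :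
    ∃ n e₀ e₁, IsLineMul (fun i => unsigma b (c i)) n e₀ e₁ := by
  obtain ⟨hli, -, -, hg⟩ := hc
  have h3 : Module.finrank F K = 3 := by simp [Module.finrank_eq_card_basis b]
  obtain ⟨φ, hφ, hφ3, -⟩ := exists_galois_generator h3
  have hφ2 : φ ^ 2 ≠ 1 := fun h => hφ (by rw [pow_succ, h, one_mul] at hφ3; exact hφ3)
  have hvan : ∀ θ ψ : K ≃ₐ[F] K, ψ ≠ θ → ∀ w ∈ transversal b,
      conjForm b ψ (conjugate θ w) = 0 := by
    intro θ ψ hne w hw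
    rw [conjForm_conjugate, conjForm_eq_zero_of_mem_transversal b hw
      (by rwa [Ne, inv_mul_eq_one, eq_comm])]
    ext; simp
  obtain ⟨s, t, hst, w, hw, h⟩ := hg φ
  obtain ⟨s', t', hst', w', hw', h'⟩ := hg (φ ^ 2)
  have hU : ∀ x y, conjForm b (1 : K ≃ₐ[F] K) (cubic (fun i => extend K (c i)) x y) =
      cubic (fun i => unsigma b (c i)) x y := fun x y => conjForm_cubic_extend 1 c x y
  refine BruckBose.exists_isLineMul (s := s) (t := t) (s' := s') (t' := t') ?_ ?_ ?_
  · rw [← hU, h, hvan _ _ hφ.symm w hw]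
  · rw [← hU, h', hvan _ _ hφ2.symm w' hw']
  -- Proportional parameters would give one nonzero vector lying on two different transversals up to
  -- scalars, and then every conjugate form would vanish on it.
  · intro hdet
    obtain ⟨k, hk⟩ : ∃ k : K, s' = k * s ∧ t' = k * t := by
      by_cases ht : t = 0
      · have hs : s ≠ 0 := fun h0 => hst (by rw [h0, ht])
        refine ⟨s' / s, by field_simp, ?_⟩
        simp_all
      · exact ⟨t' / t, by field_simp; linear_combination hdet, by field_simp⟩
    have hk0 : k ≠ 0 := by
      rintro rfl
      exact hst' (by simp [hk])
    have hscale : cubic (fun i => extend K (c i)) s' t' =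
        k ^ 3 • cubic (fun i => extend K (c i)) s t := by
      rw [cubic, cubic, hk.1, hk.2]
      module
    refine cubic_extend_ne_zero b hli hst (eq_zero_of_conjForm_eq_zero b fun ψ => ?_)
    by_cases hψ : ψ = φ
    · have hne : ψ ≠ φ ^ 2 := by
        rw [hψ, pow_two]
        exact fun h => hφ (left_eq_mul.1 h)
      have h1 := hvan _ _ hne w' hw'
      rw [← h', hscale, map_smul] at h1
      exact (smul_eq_zero.1 h1).resolve_left (pow_ne_zero 3 hk0)
    · rw [h, hvan _ _ hψ w hw]

theorem unsigma_cubic {c : Fin 4 → V7 F} {n e₀ e₁ : Fin 3 → K}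
    (h : IsLineMul (fun i => unsigma b (c i)) n e₀ e₁) (s t : F) :
    unsigma b (cubic c s t) =
      quadratic n (algebraMap F K s) (algebraMap F K t) • (s • e₀ + t • e₁) := by
  rw [map_cubic, ← cubic_algebraMap (K := K), h.cubic_eq, algebraMap_smul, algebraMap_smul]

/-- Write the cubic as `N · l` with `l = s e₀ + t e₁`. Eliminating the last coordinate between it
and a partial derivative `N' l + N l'` cancels the terms in `N'` and leaves `N² (l₂ l' - l'₂ l)`, a
multiple of the vector shown. No division by 3 occurs, so characteristic 3 is included. -/
theorem cubicTangent_inf_hyperplane {c : Fin 4 → V7 F} {n e₀ e₁ : Fin 3 → K}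
    (h : IsLineMul (fun i => unsigma b (c i)) n e₀ e₁) {s t : F} (hst : (s, t) ≠ (0, 0))
    (hz : (cubic c s t).2.2 ≠ 0) :
    cubicTangent c s t ⊓ hyperplaneAtInfinity F =
      (Submodule.span F {quadratic n (algebraMap F K s) (algebraMap F K t) ^ 2 •
        (e₀ 2 • e₁ - e₁ 2 • e₀)}).comap (unsigma b) := by
  set f := (cubic c s t).2.2 with hf
  set g := quadratic n (algebraMap F K s) (algebraMap F K t) ^ 2 • (e₀ 2 • e₁ - e₁ 2 • e₀) with hg
  set Ds := (3 * s ^ 2) • c 0 + (2 * s * t) • c 1 + t ^ 2 • c 2 with hDs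
  set Dt := s ^ 2 • c 1 + (2 * s * t) • c 2 + (3 * t ^ 2) • c 3 with hDt
  have hfK : algebraMap F K f = quadratic n (algebraMap F K s) (algebraMap F K t) *
      (algebraMap F K s * e₀ 2 + algebraMap F K t * e₁ 2) := by
    have := congrFun (unsigma_cubic h s t) 2
    rw [unsigma_apply_two] at this
    rw [hf, this]
    simp [Algebra.smul_def]
  have h0 : unsigma b (c 0) = _ := h.zero
  have h1 : unsigma b (c 1) = _ := h.one
  have h2 : unsigma b (c 2) = _ := h.two
  have h3 : unsigma b (c 3) = _ := h.three
  have uDs : unsigma b Ds = (3 * algebraMap F K s ^ 2) • n 0 • e₀ +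
      (2 * algebraMap F K s * algebraMap F K t) • (n 0 • e₁ + n 1 • e₀) +
      (algebraMap F K t ^ 2) • (n 1 • e₁ + n 2 • e₀) := by
    rw [← h0, ← h1, ← h2, hDs]
    ext i
    simp only [map_add, map_smul, Pi.add_apply, Pi.smul_apply, smul_eq_mul,
      Algebra.smul_def (R := F) (A := K), map_mul, map_pow, map_ofNat]
  have uDt : unsigma b Dt = (algebraMap F K s ^ 2) • (n 0 • e₁ + n 1 • e₀) +
      (2 * algebraMap F K s * algebraMap F K t) • (n 1 • e₁ + n 2 • e₀) +
      (3 * algebraMap F K t ^ 2) • n 2 • e₁ := by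
    rw [← h1, ← h2, ← h3, hDt]
    ext i
    simp only [map_add, map_smul, Pi.add_apply, Pi.smul_apply, smul_eq_mul,
      Algebra.smul_def (R := F) (A := K), map_mul, map_pow, map_ofNat]
  have zDs : algebraMap F K Ds.2.2 = _ := (unsigma_apply_two b Ds).symm.trans (congrFun uDs 2)
  have zDt : algebraMap F K Dt.2.2 = _ := (unsigma_apply_two b Dt).symm.trans (congrFun uDt 2)
  have hA : unsigma b (f • Ds - Ds.2.2 • cubic c s t) = (-t) • g := by
    rw [map_sub, map_smul, map_smul, unsigma_cubic h, uDs, ← algebraMap_smul K f,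
      ← algebraMap_smul K Ds.2.2, zDs, hfK, hg]
    ext i
    simp only [Pi.sub_apply, Pi.add_apply, Pi.smul_apply, smul_eq_mul,
      Algebra.smul_def (R := F) (A := K), map_neg, quadratic]
    ring
  have hB : unsigma b (f • Dt - Dt.2.2 • cubic c s t) = s • g := by
    rw [map_sub, map_smul, map_smul, unsigma_cubic h, uDt, ← algebraMap_smul K f,
      ← algebraMap_smul K Dt.2.2, zDt, hfK, hg]
    ext i
    simp only [Pi.sub_apply, Pi.add_apply, Pi.smul_apply, smul_eq_mul,
      Algebra.smul_def (R := F) (A := K), quadratic]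
    ring
  have mC : cubic c s t ∈ cubicTangent c s t := Submodule.subset_span (by simp)
  have mDs : Ds ∈ cubicTangent c s t := Submodule.subset_span (by simp [Ds])
  have mDt : Dt ∈ cubicTangent c s t := Submodule.subset_span (by simp [Dt])
  have zsub : ∀ D : V7 F, f • D - D.2.2 • cubic c s t ∈ hyperplaneAtInfinity F := by
    intro D
    rw [mem_hyperplaneAtInfinity]
    simp only [Prod.snd_sub, Prod.smul_snd, smul_eq_mul, ← hf]
    ring
  ext w
  rw [Submodule.mem_comap, Submodule.mem_span_singleton, Submodule.mem_inf]
  constructor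
  · rintro ⟨hw, hw0⟩
    obtain ⟨α, β, γ, hαw⟩ := Submodule.mem_span_triple.1 hw
    replace hαw : w = α • cubic c s t + β • Ds + γ • Dt := hαw.symm
    have hw0' : α * f + β * Ds.2.2 + γ * Dt.2.2 = 0 := by
      rw [mem_hyperplaneAtInfinity, hαw] at hw0
      exact hw0
    refine ⟨f⁻¹ * (γ * s - β * t), ?_⟩
    have e1 : f • w =
        β • (f • Ds - Ds.2.2 • cubic c s t) + γ • (f • Dt - Dt.2.2 • cubic c s t) := by
      have : α * f = -(β * Ds.2.2 + γ * Dt.2.2) := by linear_combination hw0'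
      rw [hαw, smul_add, smul_add, smul_smul f α, mul_comm f α, this]
      module
    have e2 := congrArg (unsigma b) e1
    rw [map_smul, map_add, map_smul (unsigma b) β, map_smul (unsigma b) γ, hA, hB] at e2
    rw [mul_smul, inv_smul_eq_iff₀ hz, e2]
    module
  · rintro ⟨a, ha⟩
    -- The two eliminations give `-t` and `s` times `g`; at least one of these factors is
    -- invertible.
    by_cases hs : s = 0
    · have ht : t ≠ 0 := fun h0 => hst (by rw [hs, h0])
      have : w = (-(a / t)) • (f • Ds - Ds.2.2 • cubic c s t) := by
        apply unsigma_injective b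
        rw [map_smul, hA, ← ha, smul_smul]
        congr 1
        field_simp
      rw [this]
      exact ⟨Submodule.smul_mem _ _ (Submodule.sub_mem _ (Submodule.smul_mem _ _ mDs)
        (Submodule.smul_mem _ _ mC)), Submodule.smul_mem _ _ (zsub _)⟩
    · have : w = (a / s) • (f • Dt - Dt.2.2 • cubic c s t) := by
        apply unsigma_injective b
        rw [map_smul, hB, ← ha, smul_smul]
        congr 1
        field_simp
      rw [this]
      exact ⟨Submodule.smul_mem _ _ (Submodule.sub_mem _ (Submodule.smul_mem _ _ mDt)
        (Submodule.smul_mem _ _ mC)), Submodule.smul_mem _ _ (zsub _)⟩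

end SpecialCubic

/-! ### The tangent point does not depend on the special cubic chosen. -/

section TangentPoint

variable {F K : Type*} [Field F] [Field K] [Algebra F K] {b : Module.Basis (Fin 3) F K}

theorem smul_add_smul_apply_two_ne_zero {v r : Fin 3 → K} (hv : v 2 = 1)
    (hr : ∀ a : F, algebraMap F K a ≠ r 2) {x y : F} (hxy : (x, y) ≠ (0, 0)) :
    (x • v + y • r) 2 ≠ 0 := by
  intro h
  have h2 : algebraMap F K x + algebraMap F K y * r 2 = 0 := by
    simpa [Algebra.smul_def, hv] using h
  by_cases hy : y = 0
  · subst hy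
    exact hxy (by simpa using h2)
  · have hy' : algebraMap F K y ≠ 0 := by simpa using hy
    refine hr (-x / y) ?_
    rw [map_div₀, map_neg]
    field_simp
    linear_combination -h2

theorem exists_eq_smul_of_cubicPoints {v r : Fin 3 → K} (hv : v 2 = 1)
    (hr : ∀ a : F, algebraMap F K a ≠ r 2) {c : Fin 4 → V7 F} {n e₀ e₁ : Fin 3 → K}
    (h : IsLineMul (fun i => unsigma b (c i)) n e₀ e₁)
    (hc : cubicPoints c = bruckBose b '' formPoints (Submodule.span F {v, r})) {s t : F}
    (hst : (s, t) ≠ (0, 0)) :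
    ∃ (ν : K) (x y : F), s • e₀ + t • e₁ = ν • (x • v + y • r) := by
  obtain ⟨X, ⟨w, hw, hw0, hwX⟩, hX⟩ : Submodule.span F {cubic c s t} ∈
      bruckBose b '' formPoints (Submodule.span F {v, r}) := hc ▸ ⟨s, t, hst, rfl⟩
  obtain ⟨x, y, rfl⟩ := Submodule.mem_span_pair.1 hw
  have hmem : unsigma b (cubic c s t) ∈ X.submodule :=
    mem_bruckBose b |>.1 (hX ▸ Submodule.mem_span_singleton_self _)
  rw [submodule_eq_span hw0 hwX] at hmem
  obtain ⟨κ, hκ⟩ := Submodule.mem_span_singleton.1 hmem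
  rw [unsigma_cubic h] at hκ
  have hN : quadratic n (algebraMap F K s) (algebraMap F K t) ≠ 0 := by
    intro hN
    have hzero : cubic c s t = 0 := by
      apply unsigma_injective b
      rw [unsigma_cubic h, hN, zero_smul, map_zero]
    rw [hzero, Submodule.span_zero_singleton] at hX
    have hxy : (x, y) ≠ (0, 0) := by rintro ⟨⟩; simp at hw0
    have hz := smul_add_smul_apply_two_ne_zero hv hr hxy
    obtain ⟨u, hu, hu2⟩ := exists_unsigma_eq b
      (((x • v + y • r) 2)⁻¹ • (x • v + y • r)) 1 (by simp [-Pi.add_apply, hz])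
    have : u ∈ bruckBose b X := by
      rw [mem_bruckBose, hu]; exact Submodule.smul_mem _ _ hwX
    rw [hX, Submodule.mem_bot] at this
    simp [this] at hu2
  refine ⟨(quadratic n (algebraMap F K s) (algebraMap F K t))⁻¹ * κ, x, y, ?_⟩
  rw [mul_smul, hκ, inv_smul_smul₀ hN]

/-- Both `(e₀, e₁)` and `(v, r)` parametrize the same subline, so they differ by a change of basis
over `F` and one scalar in `K`. Three parameters suffice to see this: the given one, a second one
and their sum. -/
theorem exists_algebraMap_smul_eq {v r : Fin 3 → K} (hvr : LinearIndependent K ![v, r])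
    (hv : v 2 = 1) {e₀ e₁ : Fin 3 → K}
    (hV : ∀ s t : F, (s, t) ≠ (0, 0) →
      ∃ (ν : K) (x y : F), s • e₀ + t • e₁ = ν • (x • v + y • r))
    {s t : F} (hst : (s, t) ≠ (0, 0)) {μ : K} (hμ : s • e₀ + t • e₁ = μ • v) (hμ0 : μ ≠ 0) :
    ∃ a : F, e₀ 2 • e₁ - e₁ 2 • e₀ = (μ ^ 2 * algebraMap F K a) • (r - r 2 • v) := by
  rw [LinearIndependent.pair_iff] at hvr
  obtain ⟨s', t', hdet⟩ : ∃ s' t' : F, s * t' - s' * t ≠ 0 := by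
    by_cases ht : t = 0
    · exact ⟨0, 1, by simpa [ht] using hst⟩
    · exact ⟨1, 0, by simpa using ht⟩
  have hdetK : algebraMap F K s * algebraMap F K t' - algebraMap F K s' * algebraMap F K t ≠ 0 := by
    rw [← map_mul, ← map_mul, ← map_sub]
    exact (map_ne_zero _).2 hdet
  obtain ⟨ν, x, y, hν⟩ := hV s' t' (by rintro ⟨⟩; simp at hdet)
  obtain ⟨ρ, x', y', hρ⟩ := hV (s + s') (t + t') (by
    intro h0
    rw [Prod.mk.injEq] at h0
    exact hdet (by linear_combination t' * h0.1 - s' * h0.2))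
  have hg : (algebraMap F K s * algebraMap F K t' - algebraMap F K s' * algebraMap F K t) •
      (e₀ 2 • e₁ - e₁ 2 • e₀) = (μ * (ν * algebraMap F K y)) • (r - r 2 • v) := by
    have h1 : (s • e₀ + t • e₁) 2 • (s' • e₀ + t' • e₁) -
        (s' • e₀ + t' • e₁) 2 • (s • e₀ + t • e₁) =
        (algebraMap F K s * algebraMap F K t' - algebraMap F K s' * algebraMap F K t) •
          (e₀ 2 • e₁ - e₁ 2 • e₀) := by
      ext i
      simp only [Pi.add_apply, Pi.sub_apply, Pi.smul_apply, smul_eq_mul,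
        Algebra.smul_def (R := F) (A := K)]
      ring
    rw [← h1, hμ, hν]
    ext i
    simp only [Pi.add_apply, Pi.sub_apply, Pi.smul_apply, smul_eq_mul,
      Algebra.smul_def (R := F) (A := K), hv]
    ring
  have hrel : (μ + ν * algebraMap F K x - ρ * algebraMap F K x') • v +
      (ν * algebraMap F K y - ρ * algebraMap F K y') • r = 0 := by
    have h2 : (s + s') • e₀ + (t + t') • e₁ = (s • e₀ + t • e₁) + (s' • e₀ + t' • e₁) := by
      module
    rw [hρ, hμ, hν] at h2
    rw [← sub_eq_zero] at h2
    rw [← neg_eq_zero, ← h2]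
    ext i
    simp only [Pi.add_apply, Pi.sub_apply, Pi.smul_apply, Pi.neg_apply, smul_eq_mul,
      Algebra.smul_def (R := F) (A := K)]
    ring
  obtain ⟨hx, hy⟩ := hvr _ _ hrel
  -- Eliminating the scalar `ρ` of the third point from `hx` and `hy` shows that `ν` and `μ` differ
  -- by a factor in `F`, unless the product is zero.
  have hνy : ∃ a : F, ν * algebraMap F K y = μ * algebraMap F K a := by
    by_cases hνy : ν * algebraMap F K y = 0
    · exact ⟨0, by simp [hνy]⟩
    have hyK := right_ne_zero_of_mul hνy
    have hy'K : algebraMap F K y' ≠ 0 := by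
      rw [sub_eq_zero.1 hy] at hνy
      exact right_ne_zero_of_mul hνy
    have hD : μ * algebraMap F K y' = ν * algebraMap F K (y * x' - x * y') := by
      rw [map_sub, map_mul, map_mul]
      linear_combination algebraMap F K y' * hx - algebraMap F K x' * hy
    have hD0 : algebraMap F K (y * x' - x * y') ≠ 0 :=
      right_ne_zero_of_mul (hD ▸ mul_ne_zero hμ0 hy'K)
    refine ⟨y * y' / (y * x' - x * y'), ?_⟩
    rw [map_div₀, map_mul]
    field_simp
    linear_combination -hD
  obtain ⟨a, ha⟩ := hνy
  refine ⟨a / (s * t' - s' * t), ?_⟩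
  rw [ha] at hg
  rw [← inv_smul_smul₀ hdetK (e₀ 2 • e₁ - e₁ 2 • e₀), hg, smul_smul]
  congr 1
  rw [map_div₀, map_sub, map_mul, map_mul]
  field_simp

/-- The factor `N ^ 2` in the tangent direction cancels the `N ^ (-2)` contained in `μ ^ 2`, where
`μ` compares the line parametrization with `v` at `P`; only a scalar of `F` remains. -/
theorem IsTangentPointAtInfinity.eq_comap [IsGalois F K] {v r : Fin 3 → K}
    (hvr : LinearIndependent K ![v, r]) (hv : v 2 = 1) (hr : ∀ a : F, algebraMap F K a ≠ r 2)
    {P : PG2 K} (hP : v ∈ P.submodule) {I : Submodule F (V7 F)}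
    (hI : IsTangentPointAtInfinity b (formPoints (Submodule.span F {v, r})) P I) :
    I = (Submodule.span F {r - r 2 • v}).comap (unsigma b) := by
  obtain ⟨hI1, c, hc, hpts, s, t, hst, hPst, rfl⟩ := hI
  obtain ⟨n, e₀, e₁, h⟩ := hc.exists_isLineMul
  have hv0 : v ≠ 0 := by rintro rfl; simp at hv
  obtain ⟨p, hp, hp2⟩ := exists_unsigma_eq b v 1 (by simpa using hv)
  have hpP : p ∈ Submodule.span F {cubic c s t} := by
    rw [← hPst, mem_bruckBose, hp]; exact hP
  obtain ⟨g, hg⟩ := Submodule.mem_span_singleton.1 hpP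
  have hgf : g * (cubic c s t).2.2 = 1 := by
    rw [← hp2, ← hg]; rfl
  have hf : (cubic c s t).2.2 ≠ 0 := right_ne_zero_of_mul_eq_one hgf
  have hg0 : algebraMap F K g ≠ 0 := by simpa using left_ne_zero_of_mul_eq_one hgf
  set N := quadratic n (algebraMap F K s) (algebraMap F K t) with hN
  have hvN : v = (algebraMap F K g * N) • (s • e₀ + t • e₁) := by
    rw [← hp, ← hg, map_smul, unsigma_cubic h, mul_smul, algebraMap_smul]
  have hN0 : N ≠ 0 := by
    intro h0
    rw [h0, mul_zero, zero_smul] at hvN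
    exact hv0 hvN
  have hμ0 : (algebraMap F K g * N)⁻¹ ≠ 0 := inv_ne_zero (mul_ne_zero hg0 hN0)
  have hμ : s • e₀ + t • e₁ = (algebraMap F K g * N)⁻¹ • v := by
    conv_rhs => rw [hvN]
    rw [inv_smul_smul₀ (mul_ne_zero hg0 hN0)]
  obtain ⟨a, ha⟩ := exists_algebraMap_smul_eq hvr hv
    (fun s t hst => exists_eq_smul_of_cubicPoints hv hr h hpts hst) hst hμ hμ0
  rw [cubicTangent_inf_hyperplane h hst hf] at hI1 ⊢
  have hdir : N ^ 2 • (e₀ 2 • e₁ - e₁ 2 • e₀) = ((g⁻¹) ^ 2 * a) • (r - r 2 • v) := by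
    rw [ha, smul_smul, ← algebraMap_smul K (g⁻¹ ^ 2 * a), map_mul, map_pow, map_inv₀]
    congr 1
    field_simp
  rw [hdir] at hI1 ⊢
  -- A zero scalar would make the intersection trivial, whereas it is a point.
  have hga : (g⁻¹) ^ 2 * a ≠ 0 := by
    intro h0
    rw [h0, zero_smul, Submodule.span_zero_singleton, Submodule.comap_bot,
      LinearMap.ker_eq_bot.2 (unsigma_injective b), finrank_bot] at hI1
    exact zero_ne_one hI1
  rw [Submodule.span_singleton_smul_eq (IsUnit.mk0 _ hga)]

end TangentPoint

/-! ### A special cubic for each subline, built from the norm. -/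

section Existence

variable {F K : Type*} [Field F] [Field K] [Algebra F K]

/-- The quadratic form `s² + n₁ s t + n₂ t²` is the cofactor of `s + τ t` in the norm of
`s + τ t`. -/
structure IsNormCofactor (F : Type*) {K : Type*} [Field F] [Field K] [Algebra F K]
    (τ n₁ n₂ : K) : Prop where
  trace : ∃ a : F, algebraMap F K a = τ + n₁
  second : ∃ a : F, algebraMap F K a = n₁ * τ + n₂
  norm : ∃ a : F, algebraMap F K a = n₂ * τ
  root : ∀ ψ : K ≃ₐ[F] K, ψ ≠ 1 → τ ^ 2 - ψ n₁ * τ + ψ n₂ = 0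
  linearIndependent : LinearIndependent F ![1, n₁, n₂]

/-- Take the sum and the product of the other two conjugates of `τ`. The elements required in `F`
are the elementary symmetric functions of the three conjugates, and independence follows by
subtracting conjugate relations, the conjugates being distinct. -/
theorem exists_isNormCofactor [IsGalois F K] (h3 : Module.finrank F K = 3) {τ : K}
    (hτ : ∀ a : F, algebraMap F K a ≠ τ) : ∃ n₁ n₂ : K, IsNormCofactor F τ n₁ n₂ := by
  have hfin : FiniteDimensional F K := Module.finite_of_finrank_pos (by omega)
  obtain ⟨φ, -, hφ3, hφ⟩ := exists_galois_generator h3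
  have h33 : ∀ x, φ (φ (φ x)) = x := fun x => by
    rw [← AlgEquiv.mul_apply, ← AlgEquiv.mul_apply, ← pow_two, ← pow_succ, hφ3, AlgEquiv.one_apply]
  have hfix : ∀ x, φ x = x → ∃ a : F, algebraMap F K a = x := fun x =>
    exists_algebraMap_eq hφ
  have d1 : φ τ ≠ τ := fun h => by
    obtain ⟨a, ha⟩ := hfix τ h
    exact hτ a ha
  have d2 : φ (φ τ) ≠ φ τ := fun h => d1 (φ.injective h)
  have d3 : φ (φ τ) ≠ τ := fun h => d1 (by rw [← h, h33, h])
  refine ⟨φ τ + φ (φ τ), φ τ * φ (φ τ), hfix _ ?_, hfix _ ?_, hfix _ ?_, ?_, ?_⟩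
  · simp only [map_add, h33]; ring
  · simp only [map_add, map_mul, h33]; ring
  · simp only [map_mul, h33]; ring
  · intro ψ hψ
    rcases hφ ψ with rfl | rfl | rfl
    · exact absurd rfl hψ
    · simp only [map_add, map_mul, h33]; ring
    · simp only [pow_two, AlgEquiv.mul_apply, map_add, map_mul, h33]; ring
  · rw [Fintype.linearIndependent_iff]
    intro g hg
    rw [Fin.sum_univ_three] at hg
    simp only [Matrix.cons_val, Algebra.smul_def, mul_one] at hg
    have hg1 := congrArg φ hg
    have hg2 := congrArg φ hg1
    simp only [map_add, map_mul, AlgEquiv.commutes, h33, map_zero] at hg1 hg2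
    have e1 : algebraMap F K (g 1) + algebraMap F K (g 2) * φ (φ τ) = 0 := by
      refine (mul_eq_zero.1 ?_).resolve_left (sub_ne_zero.2 d1)
      linear_combination hg - hg1
    have e2 : algebraMap F K (g 1) + algebraMap F K (g 2) * τ = 0 := by
      refine (mul_eq_zero.1 ?_).resolve_left (sub_ne_zero.2 d2)
      linear_combination hg1 - hg2
    have k2 : algebraMap F K (g 2) = 0 := by
      refine (mul_eq_zero.1 ?_).resolve_left (sub_ne_zero.2 d3)
      linear_combination e1 - e2
    rw [k2, zero_mul, add_zero] at e2
    rw [e2, k2, zero_mul, zero_mul, add_zero, add_zero] at hg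
    intro i
    apply (algebraMap F K).injective
    rw [map_zero]
    fin_cases i
    exacts [hg, e2, k2]

theorem IsNormCofactor.eq_zero {τ n₁ n₂ : K} (h : IsNormCofactor F τ n₁ n₂) {x y z : F}
    (h0 : algebraMap F K x + algebraMap F K y * n₁ + algebraMap F K z * n₂ = 0) :
    x = 0 ∧ y = 0 ∧ z = 0 := by
  have := Fintype.linearIndependent_iff.1 h.linearIndependent ![x, y, z]
    (by simpa [Fin.sum_univ_three, Algebra.smul_def] using h0)
  exact ⟨this 0, this 1, this 2⟩

theorem IsNormCofactor.exists_eq {τ n₁ n₂ : K} (h : IsNormCofactor F τ n₁ n₂)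
    (h3 : Module.finrank F K = 3) (κ : K) : ∃ x y z : F,
      algebraMap F K x + algebraMap F K y * n₁ + algebraMap F K z * n₂ = κ := by
  have hfin : FiniteDimensional F K := Module.finite_of_finrank_pos (by omega)
  have hspan := h.linearIndependent.span_eq_top_of_card_eq_finrank' (by simp [h3])
  have hκ : κ ∈ Submodule.span F (Set.range ![1, n₁, n₂]) := hspan ▸ Submodule.mem_top
  obtain ⟨g, hg⟩ := (Submodule.mem_span_range_iff_exists_fun F).1 hκ
  exact ⟨g 0, g 1, g 2, by simpa [Fin.sum_univ_three, Algebra.smul_def] using hg⟩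

theorem IsNormCofactor.quadratic_ne_zero {τ n₁ n₂ : K} (h : IsNormCofactor F τ n₁ n₂) {s t : F}
    (hst : (s, t) ≠ (0, 0)) :
    quadratic ![1, n₁, n₂] (algebraMap F K s) (algebraMap F K t) ≠ 0 := by
  intro h0
  obtain ⟨hs, -, ht⟩ := h.eq_zero (x := s ^ 2) (y := s * t) (z := t ^ 2) (by
    rw [← h0]; simp only [quadratic, map_mul, map_pow, Matrix.cons_val]; ring)
  exact hst (by rw [pow_eq_zero_iff two_ne_zero |>.1 hs, pow_eq_zero_iff two_ne_zero |>.1 ht])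

variable {b : Module.Basis (Fin 3) F K}

theorem conjugate_cubic_extend (φ : K ≃ₐ[F] K) (c : Fin 4 → V7 F) (s t : K) :
    conjugate φ (cubic (fun i => extend K (c i)) s t) =
      cubic (fun i => extend K (c i)) (φ s) (φ t) := by
  refine Prod.ext ?_ (Prod.ext ?_ ?_)
  · ext i; simp [conjugate, cubic, extend]
  · ext i; simp [conjugate, cubic, extend]
  · simp [conjugate, cubic, extend]

/-- Since `1, n₁, n₂` is an `F`-basis of `K`, comparing coefficients of `v` and `r` gives
independence and the spread element. The transversals are met at `(-τ, 1)`, `τ = r 2`, and its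
conjugates. -/
theorem isSpecialTwistedCubic_of_isNormCofactor [IsGalois F K] {v r : Fin 3 → K}
    (hvr : LinearIndependent K ![v, r]) (hv : v 2 = 1) {n₁ n₂ : K}
    (hn : IsNormCofactor F (r 2) n₁ n₂) {c : Fin 4 → V7 F}
    (h : IsLineMul (fun i => unsigma b (c i)) ![1, n₁, n₂] v r) :
    IsSpecialTwistedCubic b c := by
  have h3 : Module.finrank F K = 3 := by simp [Module.finrank_eq_card_basis b]
  have hpair := LinearIndependent.pair_iff.1 hvr
  have hsum : ∀ g : Fin 4 → F, unsigma b (∑ i, g i • c i) =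
      (algebraMap F K (g 0) + algebraMap F K (g 1) * n₁ + algebraMap F K (g 2) * n₂) • v +
      (algebraMap F K (g 1) + algebraMap F K (g 2) * n₁ + algebraMap F K (g 3) * n₂) • r := by
    intro g
    have h0 : unsigma b (c 0) = _ := h.zero
    have h1 : unsigma b (c 1) = _ := h.one
    have h2 : unsigma b (c 2) = _ := h.two
    have h3 : unsigma b (c 3) = _ := h.three
    simp only [Fin.sum_univ_four, map_add, map_smul, h0, h1, h2, h3, Matrix.cons_val,
      ← algebraMap_smul K (g _)]
    module
  refine ⟨?_, ?_, ?_, ?_⟩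
  · rw [Fintype.linearIndependent_iff]
    intro g hg
    have hu := hsum g
    rw [hg, map_zero] at hu
    obtain ⟨hu0, hu1⟩ := hpair _ _ hu.symm
    obtain ⟨g0, g1, g2⟩ := hn.eq_zero hu0
    obtain ⟨-, -, g3⟩ := hn.eq_zero hu1
    intro i
    fin_cases i
    exacts [g0, g1, g2, g3]
  · intro hle
    have h0 : (c 0).2.2 = 0 := hle (Submodule.subset_span ⟨0, rfl⟩)
    have h1 := congrFun h.zero 2
    simp only [unsigma_apply_two, h0] at h1
    simp [hv] at h1
  · have hne : r - r 2 • v ≠ 0 := by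
      intro h0
      have := (hpair (-(r 2)) 1 (by rw [← h0]; module)).2
      exact one_ne_zero this
    obtain ⟨X, hX⟩ := exists_point hne
    refine ⟨X, (mem_pointsOn hne hX _).2 (mem_lineAtInfinity.2 (by simp [hv])), fun w hw => ?_⟩
    rw [mem_bruckBose, submodule_eq_span hne hX, Submodule.mem_span_singleton] at hw
    obtain ⟨κ, hκ⟩ := hw
    obtain ⟨x, y, z, rfl⟩ := hn.exists_eq h3 κ
    obtain ⟨a₁, ha₁⟩ := hn.trace
    obtain ⟨a₂, ha₂⟩ := hn.second
    obtain ⟨a₃, ha₃⟩ := hn.norm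
    -- The coefficient of `r` forces the last three entries; the first is then `-κτ - x n₁ - y n₂`,
    -- which is in `F` by the symmetric functions.
    have hw : w = ∑ i, ![-(x * a₁ + y * a₂ + z * a₃), x, y, z] i • c i := by
      apply unsigma_injective b
      rw [hsum, ← hκ]
      simp only [Matrix.cons_val, map_neg, map_add, map_mul, ha₁, ha₂, ha₃]
      module
    rw [hw]
    exact Submodule.sum_mem _ fun i _ => Submodule.smul_mem _ _ (Submodule.subset_span ⟨i, rfl⟩)
  · intro φ
    refine ⟨φ (-(r 2)), φ 1, by simp, cubic (fun i => extend K (c i)) (-(r 2)) 1, ?_,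
      (conjugate_cubic_extend φ c _ _).symm⟩
    -- At `(-τ, 1)` the line factor `s + tτ` makes the last coordinate vanish, and for `ψ ≠ 1` the
    -- conjugate of the quadratic factor has a zero.
    refine mem_transversal_of_conjForm b ?_ fun ψ hψ => ?_
    · have h1 : conjForm b (1 : K ≃ₐ[F] K) (cubic (fun i => extend K (c i)) (-(r 2)) 1) =
          cubic (fun i => unsigma b (c i)) (-(r 2)) 1 := conjForm_cubic_extend 1 c _ _
      rw [h.cubic_eq] at h1
      refine (congrFun h1 2).trans ?_
      simp [hv]
    · have hψ' : IsLineMul (fun i j => ψ (unsigma b (c i) j)) (fun i => ψ (![1, n₁, n₂] i))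
          (fun i => ψ (v i)) (fun i => ψ (r i)) := by
        constructor <;> funext j
        · exact (congrArg ψ (congrFun h.zero j)).trans (by simp)
        · exact (congrArg ψ (congrFun h.one j)).trans (by simp)
        · exact (congrArg ψ (congrFun h.two j)).trans (by simp)
        · exact (congrArg ψ (congrFun h.three j)).trans (by simp)
      rw [conjForm_cubic_extend, hψ'.cubic_eq]
      have : quadratic (fun i => ψ (![1, n₁, n₂] i)) (-(r 2)) 1 = 0 := by
        rw [← hn.root ψ hψ]
        simp only [quadratic, Matrix.cons_val, map_one]
        ring
      rw [this, zero_smul]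

theorem isTangentPointAtInfinity_comap [IsGalois F K] {v r : Fin 3 → K}
    (hvr : LinearIndependent K ![v, r]) (hv : v 2 = 1) (hr : ∀ a : F, algebraMap F K a ≠ r 2)
    {P : PG2 K} (hP : v ∈ P.submodule) :
    IsTangentPointAtInfinity b (formPoints (Submodule.span F {v, r})) P
      ((Submodule.span F {r - r 2 • v}).comap (unsigma b)) := by
  have h3 : Module.finrank F K = 3 := by simp [Module.finrank_eq_card_basis b]
  obtain ⟨n₁, n₂, hn⟩ := exists_isNormCofactor h3 hr
  obtain ⟨a₁, ha₁⟩ := hn.trace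
  obtain ⟨a₂, ha₂⟩ := hn.second
  obtain ⟨a₃, ha₃⟩ := hn.norm
  -- The coefficient vectors of `(s² + n₁ s t + n₂ t²)(s v + t r)`; their last coordinates are the
  -- coefficients of the norm of `s + tτ`.
  obtain ⟨c₀, hc₀, z₀⟩ := exists_unsigma_eq b v 1 (by simpa using hv)
  obtain ⟨c₁, hc₁, z₁⟩ := exists_unsigma_eq b (r + n₁ • v) a₁ (by simp [hv, ha₁])
  obtain ⟨c₂, hc₂, z₂⟩ := exists_unsigma_eq b (n₁ • r + n₂ • v) a₂ (by simp [hv, ha₂])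
  obtain ⟨c₃, hc₃, z₃⟩ := exists_unsigma_eq b (n₂ • r) a₃ (by simp [ha₃])
  set c : Fin 4 → V7 F := ![c₀, c₁, c₂, c₃]
  have h : IsLineMul (fun i => unsigma b (c i)) ![1, n₁, n₂] v r := by
    constructor <;> simp [c, hc₀, hc₁, hc₂, hc₃]
  have hne : r - r 2 • v ≠ 0 := by
    intro h0
    have := (LinearIndependent.pair_iff.1 hvr (-(r 2)) 1 (by rw [← h0]; module)).2
    exact one_ne_zero this
  have hc10 : cubic c (1 : F) 0 = c₀ := by simp [cubic, c]
  have hz : ∀ s t : F, (s, t) ≠ (0, 0) → (cubic c s t).2.2 ≠ 0 := by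
    intro s t hst h0
    have h2 := congrFun (unsigma_cubic h s t) 2
    rw [unsigma_apply_two, h0, map_zero, Pi.smul_apply, smul_eq_mul] at h2
    exact mul_ne_zero (hn.quadratic_ne_zero hst)
      (smul_add_smul_apply_two_ne_zero hv hr hst) h2.symm
  refine ⟨?_, c, isSpecialTwistedCubic_of_isNormCofactor hvr hv hn h, ?_,
    (1 : F), (0 : F), by simp, ?_, ?_⟩
  · rw [finrank_comap_unsigma b, finrank_span_singleton hne]
    intro u hu
    obtain ⟨a, rfl⟩ := Submodule.mem_span_singleton.1 hu
    exact ⟨0, by simp [hv]⟩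
  · have hmem : ∀ (s t : F) (X : PG2 K), s • v + t • r ∈ X.submodule →
        unsigma b (cubic c s t) ∈ X.submodule := by
      intro s t X hX
      rw [unsigma_cubic h]
      exact Submodule.smul_mem _ _ hX
    ext S
    constructor
    · rintro ⟨s, t, hst, rfl⟩
      have hw0 : s • v + t • r ≠ 0 := fun h0 =>
        smul_add_smul_apply_two_ne_zero hv hr hst (by rw [h0]; rfl)
      obtain ⟨X, hX⟩ := exists_point hw0
      exact ⟨X, ⟨_, Submodule.mem_span_pair.2 ⟨s, t, rfl⟩, hw0, hX⟩,
        bruckBose_eq_span b (hz s t hst) (hmem s t X hX)⟩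
    · rintro ⟨X, ⟨w, hw, hw0, hX⟩, rfl⟩
      obtain ⟨s, t, rfl⟩ := Submodule.mem_span_pair.1 hw
      have hst : (s, t) ≠ (0, 0) := by rintro ⟨⟩; simp at hw0
      exact ⟨s, t, hst, bruckBose_eq_span b (hz s t hst) (hmem s t X hX)⟩
  · rw [hc10]
    exact bruckBose_eq_span b (by simp [z₀]) (by rwa [hc₀])
  · rw [cubicTangent_inf_hyperplane h (by simp) (hz 1 0 (by simp))]
    simp [quadratic, hv]

end Existence

/-! ### Adapted coordinates for a tangent subplane, and its lines through `P`. -/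

section Frames

variable {F K : Type*} [Field F] [Field K] [Algebra F K]

theorem linearIndependent_triple_iff {R V : Type*} [Ring R] [AddCommGroup V] [Module R V]
    {x y z : V} : LinearIndependent R ![x, y, z] ↔
      ∀ k l m : R, k • x + l • y + m • z = 0 → k = 0 ∧ l = 0 ∧ m = 0 := by
  rw [Fintype.linearIndependent_iff]
  constructor
  · intro h k l m hz
    have := h ![k, l, m] (by simpa [Fin.sum_univ_three] using hz)
    exact ⟨this 0, this 1, this 2⟩
  · intro h g hg
    obtain ⟨h0, h1, h2⟩ := h (g 0) (g 1) (g 2) (by simpa [Fin.sum_univ_three] using hg)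
    intro i
    fin_cases i
    exacts [h0, h1, h2]

theorem range_triple {α : Type*} (x y z : α) : Set.range ![x, y, z] = {x, y, z} := by
  rw [Matrix.range_cons, Matrix.range_cons, Matrix.range_cons, Matrix.range_empty,
    Set.union_empty, Set.singleton_union, Set.singleton_union]

theorem range_pair {α : Type*} (x y : α) : Set.range ![x, y] = {x, y} := by
  rw [Matrix.range_cons, Matrix.range_cons, Matrix.range_empty, Set.union_empty,
    Set.singleton_union]

theorem span_triple_eq_span_range {v : Fin 3 → Fin 3 → K} {x y z : Fin 3 → K}
    (hv : LinearIndependent F v) (hxyz : LinearIndependent F ![x, y, z])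
    (hx : x ∈ Submodule.span F (Set.range v)) (hy : y ∈ Submodule.span F (Set.range v))
    (hz : z ∈ Submodule.span F (Set.range v)) :
    Submodule.span F {x, y, z} = Submodule.span F (Set.range v) := by
  have := FiniteDimensional.span_of_finite F (Set.finite_range v)
  refine Submodule.eq_of_le_of_finrank_eq ?_ ?_
  · rw [Submodule.span_le]
    rintro w (rfl | rfl | rfl) <;> assumption
  · rw [← range_triple, finrank_span_eq_card hxyz, finrank_span_eq_card hv]

theorem linearIndependent_of_mem_span {v : Fin 3 → Fin 3 → K} {x y z : Fin 3 → K}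
    (hv : LinearIndependent K v) (hxyz : LinearIndependent F ![x, y, z])
    (hx : x ∈ Submodule.span F (Set.range v)) (hy : y ∈ Submodule.span F (Set.range v))
    (hz : z ∈ Submodule.span F (Set.range v)) : LinearIndependent K ![x, y, z] := by
  have hspan := span_triple_eq_span_range (hv.restrict_scalars' F) hxyz hx hy hz
  refine linearIndependent_of_top_le_span_of_card_eq_finrank ?_ (by simp)
  rw [← hv.span_eq_top_of_card_eq_finrank' (by simp), Submodule.span_le]
  intro w hw
  have hw' : w ∈ Submodule.span F {x, y, z} := hspan ▸ Submodule.subset_span hw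
  rw [range_triple]
  exact Submodule.span_le_restrictScalars F K _ hw'

theorem formPoints_smul {μ : K} (hμ : μ ≠ 0) (x y z : Fin 3 → K) :
    formPoints (Submodule.span F {μ • x, μ • y, μ • z}) =
      formPoints (Submodule.span F {x, y, z}) := by
  have key : ∀ k l m : F, k • μ • x + l • μ • y + m • μ • z = μ • (k • x + l • y + m • z) := by
    intro k l m
    rw [smul_add, smul_add, smul_comm k, smul_comm l, smul_comm m]
  ext X
  constructor
  · rintro ⟨w, hw, hw0, hX⟩
    obtain ⟨k, l, m, rfl⟩ := Submodule.mem_span_triple.1 hw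
    rw [key] at hw0 hX
    exact ⟨_, Submodule.mem_span_triple.2 ⟨k, l, m, rfl⟩, (smul_ne_zero_iff.1 hw0).2,
      (Submodule.smul_mem_iff _ hμ).1 hX⟩
  · rintro ⟨w, hw, hw0, hX⟩
    obtain ⟨k, l, m, rfl⟩ := Submodule.mem_span_triple.1 hw
    exact ⟨_, Submodule.mem_span_triple.2 ⟨k, l, m, rfl⟩, by rw [key]; exact smul_ne_zero hμ hw0,
      by rw [key]; exact Submodule.smul_mem _ _ hX⟩

/-- Coordinate vectors for a subplane `B` that is tangent to the line at infinity at `T`, with an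
affine point `P`. -/
structure IsFrame (F : Type*) {K : Type*} [Field F] [Field K] [Algebra F K] (B : Set (PG2 K))
    (T P : PG2 K) (v₀ v₁ v₂ : Fin 3 → K) : Prop where
  linearIndependent : LinearIndependent K ![v₀, v₁, v₂]
  eq_formPoints : B = formPoints (Submodule.span F {v₀, v₁, v₂})
  mem_P : v₀ ∈ P.submodule
  mem_T : v₁ ∈ T.submodule
  v₀_two : v₀ 2 = 1
  v₁_two : v₁ 2 = 0
  v₂_two : ∀ a : F, algebraMap F K a ≠ v₂ 2

/-- Complete vectors of `P` and `T` by a basis vector outside their `K`-span, then divide all three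
by the last coordinate of the first: a common factor in `K` does not change the subplane. -/
theorem exists_isFrame {B : Set (PG2 K)} (hB : IsSubplane F B) {T P : PG2 K}
    (hT : B ∩ pointsOn (lineAtInfinity K) = {T}) (hP : P ∈ B)
    (hPaff : P ∉ pointsOn (lineAtInfinity K)) : ∃ v₀ v₁ v₂, IsFrame F B T P v₀ v₁ v₂ := by
  obtain ⟨v, hv, rfl⟩ := isSubplane_iff.1 hB
  have hTmem : T ∈ formPoints (Submodule.span F (Set.range v)) ∩ pointsOn (lineAtInfinity K) :=
    hT ▸ Set.mem_singleton T
  obtain ⟨⟨t, htW, ht0, htT⟩, hTinf⟩ := hTmem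
  obtain ⟨p, hpW, hp0, hpP⟩ := hP
  rw [mem_pointsOn ht0 htT, mem_lineAtInfinity] at hTinf
  rw [mem_pointsOn hp0 hpP, mem_lineAtInfinity] at hPaff
  obtain ⟨i, hi⟩ : ∃ i, v i ∉ Submodule.span K {p, t} := by
    by_contra! hall
    have hle : (⊤ : Submodule K (Fin 3 → K)) ≤ Submodule.span K {p, t} := by
      rw [← hv.span_eq_top_of_card_eq_finrank' (by simp), Submodule.span_le]
      rintro _ ⟨i, rfl⟩
      exact hall i
    have h1 := Submodule.finrank_mono hle
    have h2 : Module.finrank K (Submodule.span K (Set.range ![p, t])) ≤ _ :=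
      finrank_range_le_card ![p, t]
    rw [finrank_top, Module.finrank_fin_fun, ← range_pair] at h1
    rw [Fintype.card_fin] at h2
    omega
  have hli : LinearIndependent K ![p, t, v i] := by
    rw [linearIndependent_triple_iff]
    intro k l m hz
    have hm : m = 0 := by
      by_contra hm
      refine hi (Submodule.mem_span_pair.2 ⟨-(m⁻¹ * k), -(m⁻¹ * l), ?_⟩)
      have hvi : m • v i = -(k • p + l • t) := by rw [eq_neg_iff_add_eq_zero, add_comm, hz]
      rw [← inv_smul_smul₀ hm (v i), hvi]
      module
    have hk : k = 0 := by
      have h2 := congrFun hz 2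
      simpa [hm, hTinf, hPaff] using h2
    refine ⟨hk, ?_, hm⟩
    rw [hk, hm, zero_smul, zero_smul, zero_add, add_zero] at hz
    exact (smul_eq_zero.1 hz).resolve_right ht0
  have hspan := span_triple_eq_span_range (hv.restrict_scalars' F) (hli.restrict_scalars' F)
    hpW htW (Submodule.subset_span ⟨i, rfl⟩)
  have hμ : (p 2)⁻¹ ≠ 0 := inv_ne_zero hPaff
  refine ⟨(p 2)⁻¹ • p, (p 2)⁻¹ • t, (p 2)⁻¹ • v i, ?_, ?_, Submodule.smul_mem _ _ hpP,
    Submodule.smul_mem _ _ htT, by simp [hPaff], by simp [hTinf], ?_⟩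
  · rw [linearIndependent_triple_iff] at hli ⊢
    intro k l m hz
    refine hli k l m ((smul_eq_zero.1 (?_ : (p 2)⁻¹ • _ = _)).resolve_left hμ)
    rw [← hz]
    module
  · rw [formPoints_smul hμ, hspan]
  -- If the last coordinate were `a ∈ F`, subtracting `a` times the first vector would give a point
  -- of `B` at infinity, hence `T`, against independence.
  · intro a ha
    have hu2 : (v i - a • p) 2 = 0 := by
      have : algebraMap F K a = (p 2)⁻¹ * v i 2 := ha
      simp only [Pi.sub_apply, Pi.smul_apply, Algebra.smul_def (R := F) (A := K), this]
      field_simp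
      ring
    have hne : v i - a • p ≠ 0 := by
      intro h0
      refine hi (Submodule.mem_span_pair.2 ⟨algebraMap F K a, 0, ?_⟩)
      rw [sub_eq_zero.1 h0, algebraMap_smul, zero_smul, add_zero]
    obtain ⟨X, hX⟩ := exists_point hne
    have hXT : X ∈ ({T} : Set (PG2 K)) := by
      rw [← hT]
      exact ⟨⟨_, Submodule.sub_mem _ (Submodule.subset_span ⟨i, rfl⟩)
        (Submodule.smul_mem _ _ hpW), hne, hX⟩, (mem_pointsOn hne hX _).2 hu2⟩
    rw [Set.mem_singleton_iff.1 hXT, submodule_eq_span ht0 htT,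
      Submodule.mem_span_singleton] at hX
    obtain ⟨κ, hκ⟩ := hX
    refine hi (Submodule.mem_span_pair.2 ⟨algebraMap F K a, κ, ?_⟩)
    rw [hκ, algebraMap_smul]
    abel

theorem mem_span_pair_of_isLine {L : Submodule K (Fin 3 → K)} (hL : IsLine L) {x y w : Fin 3 → K}
    (hxy : LinearIndependent K ![x, y]) (hx : x ∈ L) (hy : y ∈ L) (hw : w ∈ L) :
    ∃ k l : K, k • x + l • y = w := by
  have hle : Submodule.span K {x, y} ≤ L := by
    rw [Submodule.span_le]
    rintro u (rfl | rfl) <;> assumption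
  have heq : Submodule.span K {x, y} = L := by
    refine Submodule.eq_of_le_of_finrank_eq hle ?_
    have h := finrank_span_eq_card hxy
    rw [range_pair] at h
    rw [h, hL]
    rfl
  exact Submodule.mem_span_pair.1 (heq ▸ hw)

theorem formPoints_inter_pointsOn (W : Submodule F (Fin 3 → K)) (L : Submodule K (Fin 3 → K)) :
    formPoints W ∩ pointsOn L = formPoints (W ⊓ L.restrictScalars F) := by
  ext X
  constructor
  · rintro ⟨⟨w, hw, hw0, hX⟩, hL⟩
    exact ⟨w, ⟨hw, (mem_pointsOn hw0 hX L).1 hL⟩, hw0, hX⟩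
  · rintro ⟨w, ⟨hw, hL⟩, hw0, hX⟩
    exact ⟨⟨w, hw, hw0, hX⟩, (mem_pointsOn hw0 hX L).2 hL⟩

namespace IsFrame

variable {B : Set (PG2 K)} {T P : PG2 K} {v₀ v₁ v₂ : Fin 3 → K}

theorem v₀_ne_zero (h : IsFrame F B T P v₀ v₁ v₂) : v₀ ≠ 0 := h.linearIndependent.ne_zero 0

theorem v₁_ne_zero (h : IsFrame F B T P v₀ v₁ v₂) : v₁ ≠ 0 := h.linearIndependent.ne_zero 1

theorem eq_zero (h : IsFrame F B T P v₀ v₁ v₂)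
    {x y z : K} (h0 : x • v₀ + y • v₁ + z • v₂ = 0) : x = 0 ∧ y = 0 ∧ z = 0 :=
  linearIndependent_triple_iff.1 h.linearIndependent x y z h0

theorem linearIndependent_pair (h : IsFrame F B T P v₀ v₁ v₂)
    (k : F) : LinearIndependent K ![v₀, v₂ + k • v₁] := by
  rw [LinearIndependent.pair_iff]
  intro x y h0
  obtain ⟨hx, -, hy⟩ := h.eq_zero (x := x) (y := y * algebraMap F K k) (z := y) (by
    rw [← h0, ← algebraMap_smul K k]; module)
  exact ⟨hx, hy⟩

theorem add_smul_two (h : IsFrame F B T P v₀ v₁ v₂) (k : F) : (v₂ + k • v₁) 2 = v₂ 2 := by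
  simp [h.v₁_two]

/-- Take a second point of `B` on `L` and remove its `v₀` part. The `v₂` coefficient is nonzero, as
otherwise the point is `P` or `L` contains `T`; scale it to 1. -/
theorem exists_mem_line (h : IsFrame F B T P v₀ v₁ v₂)
    {L : Submodule K (Fin 3 → K)} (hL : IsExtendedLine B L)
    (hPL : P ∈ pointsOn L) (hTL : T ∉ pointsOn L) : ∃ k : F, v₂ + k • v₁ ∈ L := by
  rw [mem_pointsOn h.v₀_ne_zero h.mem_P] at hPL
  rw [mem_pointsOn h.v₁_ne_zero h.mem_T] at hTL
  obtain ⟨X, ⟨hXB, hXL⟩, hXP⟩ := hL.2.exists_ne P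
  rw [h.eq_formPoints] at hXB
  obtain ⟨w, hw, hw0, hwX⟩ := hXB
  rw [mem_pointsOn hw0 hwX] at hXL
  obtain ⟨x, y, z, rfl⟩ := Submodule.mem_span_triple.1 hw
  have hyz : y • v₁ + z • v₂ ∈ L := by
    have := Submodule.sub_mem _ hXL (Submodule.smul_of_tower_mem L x hPL)
    convert this using 1
    abel
  by_cases hz : z = 0
  · subst hz
    rw [zero_smul, add_zero] at hyz hw0 hwX
    by_cases hy : y = 0
    · subst hy
      rw [zero_smul, add_zero] at hw0 hwX
      exact absurd (point_eq hw0 hwX (Submodule.smul_of_tower_mem _ x h.mem_P)) hXP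
    · refine absurd ?_ hTL
      rw [← inv_smul_smul₀ hy v₁]
      exact Submodule.smul_of_tower_mem L _ hyz
  · refine ⟨z⁻¹ * y, ?_⟩
    have := Submodule.smul_of_tower_mem L z⁻¹ hyz
    rwa [smul_add, smul_smul, inv_smul_smul₀ hz, add_comm] at this

theorem span_inf_line (h : IsFrame F B T P v₀ v₁ v₂)
    {L : Submodule K (Fin 3 → K)} (hv₀ : v₀ ∈ L) (hv₁ : v₁ ∉ L) {k : F}
    (hk : v₂ + k • v₁ ∈ L) :
    Submodule.span F {v₀, v₁, v₂} ⊓ L.restrictScalars F =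
      Submodule.span F {v₀, v₂ + k • v₁} := by
  apply le_antisymm
  · rintro w ⟨hw, hwL⟩
    obtain ⟨x, y, z, rfl⟩ := Submodule.mem_span_triple.1 hw
    have hmem : (y - z * k) • v₁ ∈ L := by
      have := Submodule.sub_mem _ (Submodule.sub_mem _ hwL (Submodule.smul_of_tower_mem L x hv₀))
        (Submodule.smul_of_tower_mem L z hk)
      have he : x • v₀ + y • v₁ + z • v₂ - x • v₀ - z • (v₂ + k • v₁) = (y - z * k) • v₁ := by
        module
      rwa [he] at this
    have hyz : y - z * k = 0 := by
      by_contra hne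
      refine hv₁ ?_
      rw [← inv_smul_smul₀ hne v₁]
      exact Submodule.smul_of_tower_mem L _ hmem
    refine Submodule.mem_span_pair.2 ⟨x, z, ?_⟩
    rw [sub_eq_zero.1 hyz]
    module
  · rw [Submodule.span_le]
    rintro w (rfl | rfl)
    · exact ⟨Submodule.subset_span (by simp), hv₀⟩
    · exact ⟨Submodule.mem_span_triple.2 ⟨0, k, 1, by module⟩, hk⟩

theorem exists_eq_of_isSublineOf (h : IsFrame F B T P v₀ v₁ v₂)
    {ℓ : Set (PG2 K)} (hℓ : IsSublineOf B ℓ) (hP : P ∈ ℓ)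
    (hT : T ∉ ℓ) : ∃ k : F, ℓ = formPoints (Submodule.span F {v₀, v₂ + k • v₁}) := by
  obtain ⟨L, hL, rfl⟩ := hℓ
  have hTB : T ∈ B := by
    rw [h.eq_formPoints]
    exact ⟨v₁, Submodule.subset_span (by simp), h.v₁_ne_zero, h.mem_T⟩
  have hTL : T ∉ pointsOn L := fun hTL => hT ⟨hTB, hTL⟩
  obtain ⟨k, hk⟩ := h.exists_mem_line hL hP.2 hTL
  refine ⟨k, ?_⟩
  rw [h.eq_formPoints, formPoints_inter_pointsOn, h.span_inf_line
    ((mem_pointsOn h.v₀_ne_zero h.mem_P L).1 hP.2)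
    (fun hv => hTL ((mem_pointsOn h.v₁_ne_zero h.mem_T L).2 hv)) hk]

theorem v₁_notMem (h : IsFrame F B T P v₀ v₁ v₂)
    (k : F) : v₁ ∉ Submodule.span K {v₀, v₂ + k • v₁} := by
  intro hmem
  obtain ⟨x, y, hxy⟩ := Submodule.mem_span_pair.1 hmem
  obtain ⟨-, hy1, hy⟩ := h.eq_zero (x := x) (y := y * algebraMap F K k - 1) (z := y) (by
    rw [← sub_eq_zero.2 hxy, ← algebraMap_smul K k]; module)
  rw [hy] at hy1
  simp at hy1

theorem isExtendedLine_span (h : IsFrame F B T P v₀ v₁ v₂) (k : F) :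
    IsExtendedLine B (Submodule.span K {v₀, v₂ + k • v₁}) := by
  have hli := h.linearIndependent_pair k
  refine ⟨?_, P, ?_, ?_⟩
  · have hc := finrank_span_eq_card hli
    rwa [range_pair] at hc
  · rw [h.eq_formPoints]
    exact ⟨⟨v₀, Submodule.subset_span (by simp), h.v₀_ne_zero, h.mem_P⟩,
      (mem_pointsOn h.v₀_ne_zero h.mem_P _).2 (Submodule.subset_span (by simp))⟩
  · have hne : v₂ + k • v₁ ≠ 0 := hli.ne_zero 1
    have he : (0 : F) • v₀ + k • v₁ + (1 : F) • v₂ = v₂ + k • v₁ := by module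
    have hne' : (0 : F) • v₀ + k • v₁ + (1 : F) • v₂ ≠ 0 := by rwa [he]
    obtain ⟨X, hX⟩ := exists_point hne
    refine ⟨X, ?_, ?_⟩
    · rw [h.eq_formPoints]
      exact ⟨⟨_, Submodule.mem_span_triple.2 ⟨0, k, 1, rfl⟩, hne', by rwa [he]⟩,
        (mem_pointsOn hne hX _).2 (Submodule.subset_span (by simp))⟩
    · rintro rfl
      have hmem := h.mem_P
      rw [submodule_eq_span hne hX, Submodule.mem_span_singleton] at hmem
      obtain ⟨a, ha⟩ := hmem
      have := (LinearIndependent.pair_iff.1 hli 1 (-a) (by rw [← ha]; module)).1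
      exact one_ne_zero this

theorem isSublineOf_formPoints (h : IsFrame F B T P v₀ v₁ v₂) (k : F) :
    IsSublineOf B (formPoints (Submodule.span F {v₀, v₂ + k • v₁})) := by
  refine ⟨_, h.isExtendedLine_span k, ?_⟩
  rw [h.eq_formPoints, formPoints_inter_pointsOn, h.span_inf_line (k := k)
    (Submodule.subset_span (by simp)) (h.v₁_notMem k) (Submodule.subset_span (by simp))]

theorem P_mem_formPoints (h : IsFrame F B T P v₀ v₁ v₂)
    (k : F) : P ∈ formPoints (Submodule.span F {v₀, v₂ + k • v₁}) :=
  ⟨v₀, Submodule.subset_span (by simp), h.v₀_ne_zero, h.mem_P⟩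

theorem T_notMem_formPoints (h : IsFrame F B T P v₀ v₁ v₂) (k : F) :
    T ∉ formPoints (Submodule.span F {v₀, v₂ + k • v₁}) := by
  rintro ⟨w, hw, hw0, hwT⟩
  have hT : T ∈ pointsOn (Submodule.span K {v₀, v₂ + k • v₁}) :=
    (mem_pointsOn hw0 hwT _).2 (Submodule.span_le_restrictScalars F K _ hw)
  exact h.v₁_notMem k ((mem_pointsOn h.v₁_ne_zero h.mem_T _).1 hT)

end IsFrame

end Frames

/-! ### Planes of `PG(6,q)` that represent sets of points. -/

section Planes

variable {F K : Type*} [Field F] [Field K] [Algebra F K] {b : Module.Basis (Fin 3) F K}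

theorem exists_affine_bruckBose_eq_span {w : V7 F} (hw : w.2.2 ≠ 0) :
    ∃ X : PG2 K, X ∉ pointsOn (lineAtInfinity K) ∧ bruckBose b X = Submodule.span F {w} := by
  have hz : unsigma b w 2 ≠ 0 := by rw [unsigma_apply_two]; simpa using hw
  have hne : unsigma b w ≠ 0 := fun h => hz (by rw [h]; rfl)
  obtain ⟨X, hX⟩ := exists_point hne
  exact ⟨X, fun h => hz ((mem_pointsOn hne hX _).1 h), bruckBose_eq_span b hw hX⟩

/-- Once there is one affine vector, every vector at infinity is a difference of two affine ones. -/
theorem le_of_affine_le {π π' : Submodule F (V7 F)} (hπ : ¬ π ≤ hyperplaneAtInfinity F)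
    (h : ∀ w ∈ π, w.2.2 ≠ 0 → w ∈ π') : π ≤ π' := by
  obtain ⟨p, hp, hp0⟩ := SetLike.not_le_iff_exists.1 hπ
  rw [mem_hyperplaneAtInfinity] at hp0
  intro w hw
  by_cases hw0 : w.2.2 = 0
  · have := Submodule.sub_mem _ (h (w + p) (Submodule.add_mem _ hw hp) (by simpa [hw0] using hp0))
      (h p hp hp0)
    rwa [add_sub_cancel_right] at this
  · exact h w hw hw0

theorem IsPlaneOf.eq {D : Set (PG2 K)} {π π' : Submodule F (V7 F)} (h : IsPlaneOf b D π)
    (h' : IsPlaneOf b D π') : π = π' := by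
  have key : ∀ {π π' : Submodule F (V7 F)}, IsPlaneOf b D π → IsPlaneOf b D π' → π ≤ π' := by
    intro π π' h h'
    refine le_of_affine_le h.2.1 fun w hw hw0 => ?_
    obtain ⟨X, hX, hXw⟩ := exists_affine_bruckBose_eq_span (K := K) (b := b) hw0
    rw [← Submodule.span_singleton_le_iff_mem, ← hXw, ← h'.2.2.1 X hX, h.2.2.1 X hX, hXw,
      Submodule.span_singleton_le_iff_mem]
    exact hw
  exact le_antisymm (key h h') (key h' h)

theorem isPlaneOf_comap {W : Submodule F (Fin 3 → K)}
    (hW : ∀ u ∈ W, ∃ z : F, u 2 = algebraMap F K z) (hrank : Module.finrank F W = 3)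
    (haff : ∃ u ∈ W, u 2 ≠ 0) : IsPlaneOf b (formPoints W) (W.comap (unsigma b)) := by
  refine ⟨(finrank_comap_unsigma b hW).trans hrank, ?_, ?_, ?_⟩
  · obtain ⟨u, hu, hu2⟩ := haff
    obtain ⟨z, hz⟩ := hW u hu
    obtain ⟨w, rfl, hw⟩ := exists_unsigma_eq b u z hz
    intro hle
    have h0 : w.2.2 = 0 := hle hu
    exact hu2 (by rw [unsigma_apply_two, h0, map_zero])
  · intro X hX
    constructor
    · rintro ⟨u, hu, hu0, huX⟩
      rw [mem_pointsOn hu0 huX, mem_lineAtInfinity] at hX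
      obtain ⟨z, hz⟩ := hW u hu
      obtain ⟨w, rfl, hw⟩ := exists_unsigma_eq b u z hz
      have hw0 : w.2.2 ≠ 0 := by
        rintro h0
        exact hX (by rw [unsigma_apply_two, h0, map_zero])
      rw [bruckBose_eq_span b hw0 huX, Submodule.span_singleton_le_iff_mem]
      exact hu
    · intro hle
      obtain ⟨u, hu0, huX⟩ := exists_mem_submodule X
      rw [mem_pointsOn hu0 huX, mem_lineAtInfinity] at hX
      have hmem : (u 2)⁻¹ • u ∈ X.submodule := Submodule.smul_mem _ _ huX
      obtain ⟨w, hw, -⟩ := exists_unsigma_eq b ((u 2)⁻¹ • u) 1 (by simp [hX])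
      have hwX : w ∈ bruckBose b X := by rwa [mem_bruckBose, hw]
      have hwW : unsigma b w ∈ W := hle hwX
      rw [hw] at hwW
      exact ⟨_, hwW, smul_ne_zero (inv_ne_zero hX) hu0, hmem⟩
  · intro X _
    rw [Submodule.ne_bot_iff]
    constructor
    · rintro ⟨u, hu, hu0, huX⟩
      obtain ⟨z, hz⟩ := hW u hu
      obtain ⟨w, rfl, -⟩ := exists_unsigma_eq b u z hz
      exact ⟨w, ⟨huX, hu⟩, fun h0 => hu0 (by rw [h0, map_zero])⟩
    · rintro ⟨w, ⟨hwX, hwW⟩, hw0⟩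
      exact ⟨unsigma b w, hwW, fun h0 => hw0 (unsigma_injective b (by rw [h0, map_zero])), hwX⟩

end Planes

/-! ### The tangent subspace, the line `I_P` and the plane joining it to `P`. -/

section TangentSubspace

variable {F K : Type*} [Field F] [Field K] [Algebra F K]

/-- The three vectors are dependent over `K`, hence over `F`, because the span is an `F`-form of
`K³`. The relation gives `α / β ∈ F`: a third point on a line fixes the relative scale of two
others. -/
theorem smul_mem_span_of_smul_add_mem {v : Fin 3 → Fin 3 → K} (hv : LinearIndependent K v)
    {x y : Fin 3 → K} (hxy : LinearIndependent K ![x, y]) {α β γ : K} (hβ : β ≠ 0)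
    (hγ : γ ≠ 0) (hx : α • x ∈ Submodule.span F (Set.range v))
    (hy : β • y ∈ Submodule.span F (Set.range v))
    (hz : γ • (x + y) ∈ Submodule.span F (Set.range v)) :
    α • y ∈ Submodule.span F (Set.range v) := by
  have hdep : ¬ LinearIndependent F ![α • x, β • y, γ • (x + y)] := by
    intro hli
    have hK := linearIndependent_of_mem_span hv hli hx hy hz
    have h0 := (linearIndependent_triple_iff.1 hK (γ * β) (γ * α) (-(α * β)) (by module)).1
    exact mul_ne_zero hγ hβ h0
  rw [linearIndependent_triple_iff] at hdep
  push Not at hdep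
  obtain ⟨k, l, m, h0, hne⟩ := hdep
  obtain ⟨hk, hl⟩ := LinearIndependent.pair_iff.1 hxy
    (algebraMap F K k * α + algebraMap F K m * γ) (algebraMap F K l * β + algebraMap F K m * γ) (by
      rw [← h0]
      simp only [← algebraMap_smul K k, ← algebraMap_smul K l, ← algebraMap_smul K m]
      module)
  have hk0 : k ≠ 0 := by
    rintro rfl
    have hm : m = 0 := by simpa [hγ] using hk
    subst hm
    have hl0 : l = 0 := by simpa [hβ] using hl
    exact hne rfl hl0 rfl
  have hkK : algebraMap F K k ≠ 0 := by simpa using hk0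
  have he : α • y = (l / k) • β • y := by
    rw [← algebraMap_smul K (l / k), smul_smul, map_div₀]
    congr 1
    field_simp
    linear_combination hk - hl
  rw [he]
  exact Submodule.smul_mem _ _ hy

namespace IsFrame

variable {B : Set (PG2 K)} {T P : PG2 K} {v₀ v₁ v₂ : Fin 3 → K}

theorem linearIndependent_tangent (h : IsFrame F B T P v₀ v₁ v₂) :
    LinearIndependent K ![v₀, v₁, v₂ - v₂ 2 • v₀] := by
  rw [linearIndependent_triple_iff]
  intro x y z h0
  obtain ⟨hx, hy, hz⟩ := h.eq_zero (x := x - z * v₂ 2) (y := y) (z := z) (by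
    rw [← h0]; module)
  rw [hz, zero_mul, sub_zero] at hx
  exact ⟨hx, hy, hz⟩

theorem mem_formPoints_of_directionsAt (h : IsFrame F B T P v₀ v₁ v₂) :
    directionsAt B P ⊆ formPoints (Submodule.span F {v₀, v₁, v₂ - v₂ 2 • v₀}) := by
  rintro X ⟨hXinf, L, hL, hPL, hXL⟩
  obtain ⟨w, hw0, hwX⟩ := exists_mem_submodule X
  rw [mem_pointsOn hw0 hwX] at hXinf hXL
  rw [mem_lineAtInfinity] at hXinf
  have hv₀ := (mem_pointsOn h.v₀_ne_zero h.mem_P L).1 hPL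
  by_cases hTL : T ∈ pointsOn L
  · have hv₁ := (mem_pointsOn h.v₁_ne_zero h.mem_T L).1 hTL
    have hli : LinearIndependent K ![v₀, v₁] := by
      rw [LinearIndependent.pair_iff]
      intro x y h0
      obtain ⟨hx, hy, -⟩ := h.eq_zero (x := x) (y := y) (z := 0) (by rw [← h0]; module)
      exact ⟨hx, hy⟩
    obtain ⟨x, y, rfl⟩ := mem_span_pair_of_isLine hL.1 hli hv₀ hv₁ hXL
    have hx : x = 0 := by simpa [h.v₀_two, h.v₁_two] using hXinf
    subst hx
    rw [zero_smul, zero_add] at hwX hw0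
    exact ⟨v₁, Submodule.subset_span (by simp), h.v₁_ne_zero,
      (Submodule.smul_mem_iff _ (smul_ne_zero_iff.1 hw0).1).1 hwX⟩
  · obtain ⟨k, hk⟩ := h.exists_mem_line hL hPL hTL
    obtain ⟨x, y, rfl⟩ := mem_span_pair_of_isLine hL.1 (h.linearIndependent_pair k) hv₀ hk hXL
    have hx : x = -(y * v₂ 2) := by
      rw [← add_eq_zero_iff_eq_neg]
      simpa [h.v₀_two, h.v₁_two] using hXinf
    -- Vanishing of the last coordinate determines `x` from `y`, so up to the scalar `y` the vector
    -- is `k v₁ + (v₂ - τ v₀)`.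
    have he : x • v₀ + y • (v₂ + k • v₁) =
        y • ((0 : F) • v₀ + k • v₁ + (1 : F) • (v₂ - v₂ 2 • v₀)) := by
      rw [hx, zero_smul, zero_add, one_smul]
      module
    rw [he] at hwX hw0
    exact ⟨_, Submodule.mem_span_triple.2 ⟨0, k, 1, rfl⟩, (smul_ne_zero_iff.1 hw0).2,
      (Submodule.smul_mem_iff _ (smul_ne_zero_iff.1 hw0).1).1 hwX⟩

theorem mem_sup_iff (h : IsFrame F B T P v₀ v₁ v₂) {w : Fin 3 → K} :
    w ∈ P.submodule ⊔ T.submodule ↔ ∃ x y : K, x • v₀ + y • v₁ = w := by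
  rw [submodule_eq_span h.v₀_ne_zero h.mem_P, submodule_eq_span h.v₁_ne_zero h.mem_T,
    ← Submodule.span_insert, Submodule.mem_span_pair]

theorem isTangentSubspace (h : IsFrame F B T P v₀ v₁ v₂) :
    IsTangentSubspace F B T P (formPoints (Submodule.span F {v₀, v₁, v₂ - v₂ 2 • v₀})) := by
  refine ⟨isSubplane_iff.2 ⟨_, h.linearIndependent_tangent, by rw [range_triple]⟩,
    h.mem_formPoints_of_directionsAt, ?_⟩
  rintro X ⟨hXB, hX⟩
  rw [h.eq_formPoints] at hXB
  obtain ⟨w, hw, hw0, hwX⟩ := hXB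
  rw [mem_pointsOn hw0 hwX, h.mem_sup_iff] at hX
  obtain ⟨x', y', hxy⟩ := hX
  obtain ⟨x, y, z, rfl⟩ := Submodule.mem_span_triple.1 hw
  have hz : algebraMap F K z = 0 := by
    refine (h.eq_zero (x := algebraMap F K x - x') (y := algebraMap F K y - y') ?_).2.2
    rw [← sub_eq_zero] at hxy
    rw [← neg_eq_zero, ← hxy, sub_smul, sub_smul]
    simp only [algebraMap_smul]
    abel
  have hz0 : z = 0 := by simpa using hz
  refine ⟨_, Submodule.mem_span_triple.2 ⟨x, y, 0, ?_⟩, hw0, hwX⟩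
  rw [hz0, zero_smul, zero_smul]

/-- The points of `v₁`, `v₀`, `v₁ + v₀` lie on `PT`, those of `v₁`, `v₂ - τ v₀` and their sum at
infinity. Each triple ties its scalars to that of `v₁`, so a single `α` works for all three basis
vectors and can be dropped. -/
theorem isTangentSubspace_eq (h : IsFrame F B T P v₀ v₁ v₂) {D : Set (PG2 K)}
    (hD : IsTangentSubspace F B T P D) :
    D = formPoints (Submodule.span F {v₀, v₁, v₂ - v₂ 2 • v₀}) := by
  obtain ⟨hsub, hdir, hPT⟩ := hD
  obtain ⟨v, hv, rfl⟩ := isSubplane_iff.1 hsub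
  have hscale : ∀ {x : Fin 3 → K}, x ≠ 0 →
      (∀ X : PG2 K, x ∈ X.submodule → X ∈ formPoints (Submodule.span F (Set.range v))) →
      ∃ α : K, α ≠ 0 ∧ α • x ∈ Submodule.span F (Set.range v) := by
    intro x hx0 hx
    obtain ⟨X, hX⟩ := exists_point hx0
    obtain ⟨w, hw, hw0, hwX⟩ := hx X hX
    rw [submodule_eq_span hx0 hX] at hwX
    obtain ⟨α, rfl⟩ := Submodule.mem_span_singleton.1 hwX
    exact ⟨α, (smul_ne_zero_iff.1 hw0).1, hw⟩
  have hline : ∀ x y : F, (x • v₀ + y • v₁) ≠ 0 → ∀ X : PG2 K, x • v₀ + y • v₁ ∈ X.submodule →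
      X ∈ formPoints (Submodule.span F (Set.range v)) := by
    intro x y h0 X hX
    refine hPT ⟨?_, ?_⟩
    · rw [h.eq_formPoints]
      refine ⟨_, Submodule.mem_span_triple.2 ⟨x, y, 0, ?_⟩, h0, hX⟩
      rw [zero_smul, add_zero]
    · rw [mem_pointsOn h0 hX, h.mem_sup_iff]
      exact ⟨algebraMap F K x, algebraMap F K y, by simp only [algebraMap_smul]⟩
  have hu : ∀ k : F, (v₂ + k • v₁ - v₂ 2 • v₀) ≠ 0 → ∀ X : PG2 K,
      v₂ + k • v₁ - v₂ 2 • v₀ ∈ X.submodule →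
      X ∈ formPoints (Submodule.span F (Set.range v)) := by
    intro k h0 X hX
    refine hdir ⟨(mem_pointsOn h0 hX _).2 (mem_lineAtInfinity.2 ?_), _, h.isExtendedLine_span k,
      (mem_pointsOn h.v₀_ne_zero h.mem_P _).2 (Submodule.subset_span (by simp)),
      (mem_pointsOn h0 hX _).2 (Submodule.mem_span_pair.2 ⟨-v₂ 2, 1, by module⟩)⟩
    simp [h.v₀_two, h.v₁_two]
  have hli := h.linearIndependent_tangent
  have hli' := linearIndependent_triple_iff.1 hli
  obtain ⟨α, hα, hαv⟩ := hscale h.v₁_ne_zero fun X hX => by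
    refine hline 0 1 ?_ X ?_ <;> rw [zero_smul, zero_add, one_smul]
    exacts [h.v₁_ne_zero, hX]
  obtain ⟨β, hβ, hβv⟩ := hscale h.v₀_ne_zero fun X hX => by
    refine hline 1 0 ?_ X ?_ <;> rw [zero_smul, add_zero, one_smul]
    exacts [h.v₀_ne_zero, hX]
  have h01 : v₁ + v₀ ≠ 0 := fun h0 =>
    one_ne_zero (hli' 1 1 0 (by rw [← h0]; module)).1
  obtain ⟨γ, hγ, hγv⟩ := hscale h01 fun X hX => by
    have he : (1 : F) • v₀ + (1 : F) • v₁ = v₁ + v₀ := by module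
    exact hline 1 1 (by rwa [he]) X (by rwa [he])
  have hu0 : v₂ - v₂ 2 • v₀ ≠ 0 := hli.ne_zero 2
  obtain ⟨δ, hδ, hδv⟩ := hscale hu0 fun X hX => by
    have he : v₂ + (0 : F) • v₁ - v₂ 2 • v₀ = v₂ - v₂ 2 • v₀ := by rw [zero_smul, add_zero]
    exact hu 0 (by rwa [he]) X (by rwa [he])
  have hu1 : v₁ + (v₂ - v₂ 2 • v₀) ≠ 0 := fun h0 =>
    one_ne_zero (hli' 0 1 1 (by rw [← h0]; module)).2.1
  obtain ⟨ε, hε, hεv⟩ := hscale hu1 fun X hX => by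
    have he : v₂ + (1 : F) • v₁ - v₂ 2 • v₀ = v₁ + (v₂ - v₂ 2 • v₀) := by rw [one_smul]; abel
    exact hu 1 (by rwa [he]) X (by rwa [he])
  have hα₀ : α • v₀ ∈ Submodule.span F (Set.range v) :=
    smul_mem_span_of_smul_add_mem hv (LinearIndependent.pair_iff.2 fun x y h0 => by
      obtain ⟨hy, hx, -⟩ := hli' y x 0 (by rw [← h0]; module)
      exact ⟨hx, hy⟩) hβ hγ hαv hβv hγv
  have hα₂ : α • (v₂ - v₂ 2 • v₀) ∈ Submodule.span F (Set.range v) :=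
    smul_mem_span_of_smul_add_mem hv (LinearIndependent.pair_iff.2 fun x y h0 => by
      obtain ⟨-, hx, hy⟩ := hli' 0 x y (by rw [← h0]; module)
      exact ⟨hx, hy⟩) hδ hε hαv hδv hεv
  have hαli : LinearIndependent K ![α • v₀, α • v₁, α • (v₂ - v₂ 2 • v₀)] := by
    rw [linearIndependent_triple_iff]
    intro x y z h0
    refine hli' x y z ((smul_eq_zero.1 (?_ : α • _ = _)).resolve_left hα)
    rw [← h0]
    module
  rw [← span_triple_eq_span_range (hv.restrict_scalars' F) (hαli.restrict_scalars' F) hα₀ hαv hα₂,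
    formPoints_smul hα]

theorem finrank_tangentLine (h : IsFrame F B T P v₀ v₁ v₂) :
    Module.finrank F (Submodule.span F {v₁, v₂ - v₂ 2 • v₀}) = 2 := by
  have hli : LinearIndependent K ![v₁, v₂ - v₂ 2 • v₀] := LinearIndependent.pair_iff.2
    fun x y h0 => (linearIndependent_triple_iff.1 h.linearIndependent_tangent 0 x y
      (by rw [← h0]; module)).2
  have hc := finrank_span_eq_card (hli.restrict_scalars' F)
  rwa [range_pair] at hc

theorem apply_two_tangentLine (h : IsFrame F B T P v₀ v₁ v₂) {u : Fin 3 → K}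
    (hu : u ∈ Submodule.span F {v₁, v₂ - v₂ 2 • v₀}) : u 2 = 0 := by
  obtain ⟨x, y, rfl⟩ := Submodule.mem_span_pair.1 hu
  simp [h.v₀_two, h.v₁_two]

theorem sub_smul_eq (h : IsFrame F B T P v₀ v₁ v₂) (k : F) :
    v₂ + k • v₁ - (v₂ + k • v₁) 2 • v₀ = k • v₁ + (1 : F) • (v₂ - v₂ 2 • v₀) := by
  rw [h.add_smul_two, one_smul]
  abel

variable {b : Module.Basis (Fin 3) F K}

theorem tangentPoint_iff [IsGalois F K] (h : IsFrame F B T P v₀ v₁ v₂) (k : F)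
    {I : Submodule F (V7 F)} :
    IsTangentPointAtInfinity b (formPoints (Submodule.span F {v₀, v₂ + k • v₁})) P I ↔
      I = (Submodule.span F {k • v₁ + (1 : F) • (v₂ - v₂ 2 • v₀)}).comap (unsigma b) := by
  have hr : ∀ a : F, algebraMap F K a ≠ (v₂ + k • v₁) 2 := by
    rw [h.add_smul_two]
    exact h.v₂_two
  rw [← h.sub_smul_eq]
  constructor
  · exact IsTangentPointAtInfinity.eq_comap (h.linearIndependent_pair k) h.v₀_two hr h.mem_P
  · rintro rfl
    exact isTangentPointAtInfinity_comap (h.linearIndependent_pair k) h.v₀_two hr h.mem_P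

/-- The tangent points for `k = 0` and `k = 1` are distinct and span the line, also when `q = 2`. -/
theorem isLineIP_iff [IsGalois F K] (h : IsFrame F B T P v₀ v₁ v₂) {J : Submodule F (V7 F)} :
    IsLineIP b B T P J ↔
      J = (Submodule.span F {v₁, v₂ - v₂ 2 • v₀}).comap (unsigma b) := by
  have hfin : Module.finrank F ((Submodule.span F {v₁, v₂ - v₂ 2 • v₀}).comap (unsigma b)) = 2 := by
    rw [finrank_comap_unsigma b, h.finrank_tangentLine]
    exact fun u hu => ⟨0, by rw [h.apply_two_tangentLine hu, map_zero]⟩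
  constructor
  · rintro ⟨hJ, hI⟩
    refine (Submodule.eq_of_le_of_finrank_eq ?_ (hfin.trans hJ.symm)).symm
    have hk : ∀ (k : F) (w : V7 F), unsigma b w = k • v₁ + (1 : F) • (v₂ - v₂ 2 • v₀) → w ∈ J := by
      intro k w hw
      refine hI _ (h.isSublineOf_formPoints k) (h.P_mem_formPoints k) (h.T_notMem_formPoints k) _
        ((h.tangentPoint_iff k).2 rfl) ?_
      rw [Submodule.mem_comap, hw]
      exact Submodule.mem_span_singleton_self _
    obtain ⟨w₀, hw₀, -⟩ := exists_unsigma_eq b ((0 : F) • v₁ + (1 : F) • (v₂ - v₂ 2 • v₀)) 0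
      (by simp [h.v₀_two])
    obtain ⟨w₁, hw₁, -⟩ := exists_unsigma_eq b ((1 : F) • v₁ + (1 : F) • (v₂ - v₂ 2 • v₀)) 0
      (by simp [h.v₀_two, h.v₁_two])
    intro w hw
    obtain ⟨x, y, hxy⟩ := Submodule.mem_span_pair.1 (Submodule.mem_comap.1 hw)
    have : w = x • w₁ + (y - x) • w₀ := by
      apply unsigma_injective b
      rw [map_add, map_smul, map_smul, hw₀, hw₁, ← hxy, one_smul, one_smul, zero_smul]
      module
    rw [this]
    exact Submodule.add_mem _ (Submodule.smul_mem _ _ (hk 1 _ hw₁))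
      (Submodule.smul_mem _ _ (hk 0 _ hw₀))
  · rintro rfl
    refine ⟨hfin, fun ℓ hℓ hPℓ hTℓ I hI => ?_⟩
    obtain ⟨k, rfl⟩ := h.exists_eq_of_isSublineOf hℓ hPℓ hTℓ
    rw [(h.tangentPoint_iff k).1 hI]
    refine Submodule.comap_mono ?_
    rw [Submodule.span_singleton_le_iff_mem]
    exact Submodule.mem_span_pair.2 ⟨k, 1, rfl⟩

theorem isPlaneOf_comap (h : IsFrame F B T P v₀ v₁ v₂) :
    IsPlaneOf b (formPoints (Submodule.span F {v₀, v₁, v₂ - v₂ 2 • v₀}))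
      ((Submodule.span F {v₀, v₁, v₂ - v₂ 2 • v₀}).comap (unsigma b)) := by
  refine BruckBose.isPlaneOf_comap ?_ ?_ ⟨v₀, Submodule.subset_span (by simp), by simp [h.v₀_two]⟩
  · intro u hu
    obtain ⟨x, y, z, rfl⟩ := Submodule.mem_span_triple.1 hu
    exact ⟨x, by simp [h.v₀_two, h.v₁_two, Algebra.smul_def]⟩
  · have hc := finrank_span_eq_card (h.linearIndependent_tangent.restrict_scalars' F)
    rwa [range_triple] at hc

theorem comap_eq_sup (h : IsFrame F B T P v₀ v₁ v₂) :
    (Submodule.span F {v₀, v₁, v₂ - v₂ 2 • v₀}).comap (unsigma b) =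
      bruckBose b P ⊔ (Submodule.span F {v₁, v₂ - v₂ 2 • v₀}).comap (unsigma b) := by
  obtain ⟨p, hp, hp2⟩ := exists_unsigma_eq b v₀ 1 (by simp [h.v₀_two])
  have hP : bruckBose b P = Submodule.span F {p} :=
    bruckBose_eq_span b (by simp [hp2]) (by rw [hp]; exact h.mem_P)
  rw [hP]
  apply le_antisymm
  · intro w hw
    obtain ⟨x, y, z, hxyz⟩ := Submodule.mem_span_triple.1 (Submodule.mem_comap.1 hw)
    rw [← add_sub_cancel (x • p) w]
    refine Submodule.add_mem_sup (Submodule.smul_mem _ _ (Submodule.mem_span_singleton_self _)) ?_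
    rw [Submodule.mem_comap, map_sub, map_smul, hp, ← hxyz, add_assoc, add_sub_cancel_left]
    exact Submodule.mem_span_pair.2 ⟨y, z, rfl⟩
  · refine sup_le ?_ (Submodule.comap_mono (Submodule.span_mono (by simp)))
    rw [Submodule.span_singleton_le_iff_mem, Submodule.mem_comap, hp]
    exact Submodule.subset_span (by simp)

end IsFrame

end TangentSubspace

end BruckBose

open BruckBose
theorem theorem4p5 {F K : Type*} [Field F] [Finite F] [Field K] [Algebra F K]
    (b : Module.Basis (Fin 3) F K)
    (B : Set (PG2 K)) (hB : IsSubplane F B)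
    (T : PG2 K) (hT : B ∩ pointsOn (lineAtInfinity K) = {T})
    (P : PG2 K) (hP : P ∈ B) (hPaff : P ∉ pointsOn (lineAtInfinity K)) :
    (∀ ℓ, IsSublineOf B ℓ → P ∈ ℓ → T ∉ ℓ →
      ∃! I : Submodule F (V7 F), IsTangentPointAtInfinity b ℓ P I) ∧
    (∃! J : Submodule F (V7 F), IsLineIP b B T P J) ∧
    (∃! D : Set (PG2 K), IsTangentSubspace F B T P D) ∧
    ∀ J D, IsLineIP b B T P J → IsTangentSubspace F B T P D →
      (∃! π : Submodule F (V7 F), IsPlaneOf b D π) ∧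
      ∀ π, IsPlaneOf b D π → π = bruckBose b P ⊔ J := by
  have : FiniteDimensional F K := b.finiteDimensional_of_finite
  -- Finiteness of `F` serves only to make `K/F` Galois.
  have : Finite K := Module.finite_of_finite F
  have : IsGalois F K := inferInstance
  obtain ⟨v₀, v₁, v₂, h⟩ := exists_isFrame hB hT hP hPaff
  refine ⟨?_, ?_, ?_, ?_⟩
  · intro ℓ hℓ hPℓ hTℓ
    obtain ⟨k, rfl⟩ := h.exists_eq_of_isSublineOf hℓ hPℓ hTℓ
    exact ⟨_, (h.tangentPoint_iff k).2 rfl, fun I hI => (h.tangentPoint_iff k).1 hI⟩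
  · exact ⟨_, h.isLineIP_iff.2 rfl, fun J hJ => h.isLineIP_iff.1 hJ⟩
  · exact ⟨_, h.isTangentSubspace, fun D hD => h.isTangentSubspace_eq hD⟩
  · intro J D hJ hD
    obtain rfl := h.isTangentSubspace_eq hD
    rw [h.isLineIP_iff.1 hJ, ← h.comap_eq_sup]
    exact ⟨⟨_, h.isPlaneOf_comap, fun π hπ => hπ.eq h.isPlaneOf_comap⟩,
      fun π hπ => hπ.eq h.isPlaneOf_comap⟩
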